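/- Let $m\ge 2$ and $N>m$ be integers and let $I=[0,1]$. The $m$-fold zigzag map $f_{zz}\colon I\to I$ is given, for $1\le j\le m$ and $j-1\le mx<j$, by $f_{zz}(x)=mx-j+1$ if $j$ is odd and $f_{zz}(x)=j-mx$ if $j$ is even. A permutation $\sigma\in S_N$ also denotes the interval exchange map $\sigma(x)=x+(\sigma(j)-j)/N$ for $(j-1)/N\le x<j/N$, $1\le j\le N$. (Values at the single point $x=1$ are immaterial.) Each map $g=\sigma\circ f_{zz}$ preserves Lebesgue measure on $I$; its mixing rate $\tau(g)$ is the infimum of all $\tau\ge 0$ such that, for all functions $\varphi,\psi$ of bounded variation on $I$, $$\int_0^1\varphi(g^n(x))\,\psi(x)\,dx-\int_0^1\varphi(x)\,dx\int_0^1\psi(x)\,dx=O(\tau^n)\qquad(n\to\infty).$$ Put $\tilde\tau_N(f_{zz})=\max\{\tau(\sigma\circ f_{zz}):\sigma\in S_N\}$ and $d=\gcd(m,2N)$. Then $$\tilde\tau_N(f_{zz})=\frac{d\,\sin(m\pi/2N)}{m\,\sin(d\pi/2N)}.$$ In particular, if $\gcd(m,2N)=1$ then $$\tilde\tau_N(f_{zz})=\frac{\sin(m\pi/2N)}{m\,\sin(\pi/2N)}.$$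 -/

import Mathlib

open Set Filter Asymptotics MeasureTheory

noncomputable section

/-- The map `f_{ε₁, …, ε_m}` with slope `m ε_j` on `[(j-1)/m, j/m)`: for `j - 1 ≤ m x < j` it takes
the value `m x - j + 1` if `ε_j = 1` and `j - m x` if `ε_j = -1`. Only `ε 1, …, ε m` matter on
`[0, 1)`; the value at the single point `1` is immaterial. -/
def branchMap (m : ℕ) (ε : ℕ → ℤˣ) (x : ℝ) : ℝ :=
  let j : ℕ := ⌊(m : ℝ) * x⌋₊ + 1
  if ε j = 1 then m * x - j + 1 else j - m * x

/-- The `m`-fold zigzag map `f_{1, -1, 1, …}`, that is `ε_j = (-1)^(j-1)`. -/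
def zigzag (m : ℕ) : ℝ → ℝ :=
  branchMap m fun j => (-1) ^ (j - 1)

/-- The interval exchange map of a permutation `σ` of the `N` equal subintervals of `[0, 1]`:
`x ↦ x + (σ(i) - i) / N` for `i / N ≤ x < (i + 1) / N` (subintervals are numbered from `0`).
The remaining point `x = 1` of the unit interval is left fixed. -/
def intervalExchange (N : ℕ) (σ : Equiv.Perm (Fin N)) (x : ℝ) : ℝ :=
  if h : ⌊(N : ℝ) * x⌋₊ < N then
    x + (((σ ⟨⌊(N : ℝ) * x⌋₊, h⟩ : ℕ) : ℝ) - (⌊(N : ℝ) * x⌋₊ : ℝ)) / N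
  else x

/-- The correlation function `C_{φ,ψ}(n) = ∫ φ(gⁿ x) ψ(x) dμ - ∫ φ dμ ∫ ψ dμ`. -/
def correlation (μ : Measure ℝ) (g φ ψ : ℝ → ℝ) (n : ℕ) : ℝ :=
  (∫ x, φ (g^[n] x) * ψ x ∂μ) - (∫ x, φ x ∂μ) * ∫ x, ψ x ∂μ

/-- The mixing rate of a map `g` of `[0, 1]` with respect to an absolutely continuous invariant
probability measure `μ` on `[0, 1]`: the infimum of the `τ ≥ 0` with `C_{φ,ψ}(n) = O(τⁿ)` for all
`φ, ψ` of bounded variation on `[0, 1]`. -/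
def mixingRate (μ : Measure ℝ) (g : ℝ → ℝ) : ℝ :=
  sInf {τ : ℝ | 0 ≤ τ ∧ ∀ φ ψ : ℝ → ℝ,
    BoundedVariationOn φ (Icc 0 1) → BoundedVariationOn ψ (Icc 0 1) →
      (fun n => correlation μ g φ ψ n) =O[atTop] fun n : ℕ => τ ^ n}

/-- The worst mixing rate `max {τ(σ ∘ f) : σ ∈ S_N}`; the invariant measure is Lebesgue measure
on `[0, 1]`, which is preserved by every `σ ∘ f` with `f` in the family `f_{ε₁, …, ε_m}`. -/
def worstMixingRate (N : ℕ) (f : ℝ → ℝ) : ℝ :=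
  (Finset.univ : Finset (Equiv.Perm (Fin N))).sup' Finset.univ_nonempty fun σ =>
    mixingRate (volume.restrict (Icc 0 1)) (intervalExchange N σ ∘ f)

end

/-! ### Ratios of sines -/

/-! Write `g = σ ∘ f_zz`, `M = 2N/d`, `n = m/d` and `s` for the claimed rate (`zigzagRate`). The
integrals of `φ ∘ g` over the `N` mesh cells are linear functions of those of `φ`: cell `i` receives
`1/m` times a sum over `m` image cells. The decay rate is therefore governed by an `N × N` matrix, a
zigzag matrix composed with the permutation matrix of `σ`.

Upper bound: permutation matrices are isometries, so it is enough to bound the zigzag matrix on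
vectors of sum zero (`sum_zigzagFold_sq_le`). Unfolding a vector to an even `2N`-periodic sequence
turns the zigzag into window sums of length `m` at the positions `m i`. After grouping into blocks
of length `d` these become windows of length `n` on `ZMod M`, with `n` coprime to `M`. The Fourier
transform diagonalises them, and away from frequency `0` the multiplier is at most
`sin(nπ/M)/sin(π/M)` in modulus. So the cell integrals of a mean-zero observable decay like `s^n`.
Observables of bounded variation are reduced to monotone weights, for which the passage through
finer and finer meshes costs only a factor `n + 1` because `1/m ≤ s`
(`exists_abs_integral_iterate_mul_le`). Any `τ > s` absorbs that factor.

Sharpness: the extremal input is a cosine of frequency one, constant on blocks of length `d`. Its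
image is `s` times another cosine, which up to a sign `ε` takes the same values with the same
multiplicities on the `N` cells. A permutation matching the two (`exists_perm_cos`) makes a singular
vector into an eigenvector with eigenvalue `ε s`, and its autocorrelation is a nonzero multiple of
`(ε s)^n`. -/

/-- The ratio `sin(nx)/sin x` decreases in `x` as long as `nx ≤ π/2`: by the addition formula the
next ratio is `cos x` times the current one plus `cos(nx)`, and all these factors decrease. -/
lemma sin_mul_mul_sin_le {θ x : ℝ} (hθ : 0 < θ) (hx : θ ≤ x) (n : ℕ)
    (hn : n * x ≤ Real.pi / 2) :
    Real.sin (n * x) * Real.sin θ ≤ Real.sin (n * θ) * Real.sin x := by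
  induction n with
  | zero => simp
  | succ n ih =>
    push_cast at hn ⊢
    rcases Nat.eq_zero_or_pos n with rfl | hpos
    · simp [mul_comm]
    have h1 : (1 : ℝ) ≤ n := by exact_mod_cast hpos
    have hnx : n * x ≤ Real.pi / 2 := by nlinarith
    have hx2 : x ≤ Real.pi / 2 := by nlinarith
    have hnt : n * θ ≤ n * x := by gcongr
    have hnt0 : 0 < n * θ := by positivity
    have hpi := Real.pi_pos
    have c1 : Real.cos x ≤ Real.cos θ :=
      Real.cos_le_cos_of_nonneg_of_le_pi hθ.le (by linarith) hx
    have c2 : Real.cos (n * x) ≤ Real.cos (n * θ) :=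
      Real.cos_le_cos_of_nonneg_of_le_pi hnt0.le (by linarith) hnt
    have c3 : 0 ≤ Real.cos x := Real.cos_nonneg_of_mem_Icc ⟨by linarith, hx2⟩
    have s1 : 0 ≤ Real.sin x := Real.sin_nonneg_of_nonneg_of_le_pi (by linarith) (by linarith)
    have s2 : 0 ≤ Real.sin θ := Real.sin_nonneg_of_nonneg_of_le_pi (by linarith) (by linarith)
    have s3 : 0 ≤ Real.sin (n * θ) :=
      Real.sin_nonneg_of_nonneg_of_le_pi (by linarith) (by linarith)
    rw [add_one_mul, add_one_mul, Real.sin_add, Real.sin_add]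
    calc (Real.sin (n * x) * Real.cos x + Real.cos (n * x) * Real.sin x) * Real.sin θ
        = (Real.sin (n * x) * Real.sin θ) * Real.cos x
          + Real.cos (n * x) * (Real.sin x * Real.sin θ) := by ring
      _ ≤ (Real.sin (n * θ) * Real.sin x) * Real.cos θ
          + Real.cos (n * θ) * (Real.sin x * Real.sin θ) := by
        refine add_le_add (mul_le_mul (ih hnx) c1 c3 (mul_nonneg s3 s1)) ?_
        gcongr
      _ = _ := by ring

lemma abs_sin_mul_mul_sin_le_of_le_half_pi {θ x : ℝ} (hθ : 0 < θ) (hx : θ ≤ x)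
    (hx2 : x ≤ Real.pi / 2) (n : ℕ) (hn0 : 0 < n) (hn : n * θ ≤ Real.pi / 2) :
    |Real.sin (n * x)| * Real.sin θ ≤ Real.sin (n * θ) * Real.sin x := by
  have hpi := Real.pi_pos
  have hn' : (0 : ℝ) < n := by exact_mod_cast hn0
  rcases le_total (n * x) (Real.pi / 2) with h | h
  · rw [abs_of_nonneg]
    · exact sin_mul_mul_sin_le hθ hx n h
    · exact Real.sin_nonneg_of_nonneg_of_le_pi (by have := hθ.trans_le hx; positivity) (by linarith)
  -- Beyond `π/2` the numerator is only bounded by `1 = sin(n y)`, its value at `y = π/(2n)`; the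
  -- ratio at `y` is already controlled and `sin y ≤ sin x`.
  · set y := Real.pi / 2 / n with hy
    have hny : n * y = Real.pi / 2 := by rw [hy]; field_simp
    have hyx : y ≤ x := le_of_mul_le_mul_left (by linarith) hn'
    have hty : θ ≤ y := le_of_mul_le_mul_left (by linarith) hn'
    have h1 := sin_mul_mul_sin_le hθ hty n hny.le
    rw [hny, Real.sin_pi_div_two, one_mul] at h1
    have s2 : 0 ≤ Real.sin θ := Real.sin_nonneg_of_nonneg_of_le_pi (by linarith) (by linarith)
    have s3 : 0 ≤ Real.sin (n * θ) :=
      Real.sin_nonneg_of_nonneg_of_le_pi (by positivity) (by linarith)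
    calc |Real.sin (n * x)| * Real.sin θ ≤ 1 * Real.sin θ := by
          gcongr; exact Real.abs_sin_le_one _
      _ ≤ Real.sin (n * θ) * Real.sin y := by linarith
      _ ≤ _ := by
        gcongr
        exact Real.sin_le_sin_of_le_of_le_pi_div_two (by linarith) hx2 hyx

lemma abs_sin_mul_mul_sin_le {θ x : ℝ} (hθ : 0 < θ) (hx : θ ≤ x)
    (hx2 : x ≤ Real.pi - θ) (n : ℕ) (hn0 : 0 < n) (hn : n * θ ≤ Real.pi / 2) :
    |Real.sin (n * x)| * Real.sin θ ≤ Real.sin (n * θ) * Real.sin x := by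
  rcases le_total x (Real.pi / 2) with h | h
  · exact abs_sin_mul_mul_sin_le_of_le_half_pi hθ hx h n hn0 hn
  · have := abs_sin_mul_mul_sin_le_of_le_half_pi (x := Real.pi - x) hθ (by linarith) (by linarith)
      n hn0 hn
    rwa [Real.sin_pi_sub, mul_sub, Real.sin_nat_mul_pi_sub, abs_neg, abs_mul, abs_pow, abs_neg,
      abs_one, one_pow, one_mul] at this

/-! ### Moving averages on a cyclic group -/

-- Parseval's identity, obtained from Fourier inversion.
open ZMod in
lemma sum_norm_sq_dft {M : ℕ} [NeZero M] (Φ : ZMod M → ℂ) :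
    ∑ k, ‖𝓕 Φ k‖ ^ 2 = M * ∑ j, ‖Φ j‖ ^ 2 := by
  have key : ∑ k, (starRingEnd ℂ) (𝓕 Φ k) * 𝓕 Φ k = M * ∑ j, (starRingEnd ℂ) (Φ j) * Φ j := by
    have h1 : ∀ j, ∑ k, stdAddChar (k * j) • 𝓕 Φ k = (M : ℂ) * Φ j := by
      intro j
      have := congrFun (dft_dft Φ) (-j)
      rw [dft_apply] at this
      simpa using this
    have h2 : ∀ x : ZMod M, (starRingEnd ℂ) (stdAddChar (-x)) = stdAddChar x := by
      intro x
      rw [stdAddChar_apply, stdAddChar_apply, AddChar.map_neg_eq_inv, Circle.coe_inv_eq_conj]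
      simp
    calc ∑ k, (starRingEnd ℂ) (𝓕 Φ k) * 𝓕 Φ k
        = ∑ k, ∑ j, (starRingEnd ℂ) (Φ j) * (stdAddChar (k * j) • 𝓕 Φ k) := by
          refine Finset.sum_congr rfl fun k _ => ?_
          conv_lhs => rw [dft_apply, map_sum, Finset.sum_mul]
          refine Finset.sum_congr rfl fun j _ => ?_
          rw [smul_eq_mul, map_mul, h2, smul_eq_mul, ← dft_apply, mul_comm j k]
          ring
      _ = ∑ j, (starRingEnd ℂ) (Φ j) * ((M : ℂ) * Φ j) := by
          rw [Finset.sum_comm]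
          refine Finset.sum_congr rfl fun j _ => ?_
          rw [← Finset.mul_sum, h1]
      _ = _ := by
          rw [Finset.mul_sum]
          exact Finset.sum_congr rfl fun j _ => by ring
  simp only [Complex.conj_mul'] at key
  exact_mod_cast key

open ZMod in
lemma dft_comp_add_right {M : ℕ} [NeZero M] (Φ : ZMod M → ℂ) (c k : ZMod M) :
    𝓕 (fun j => Φ (j + c)) k = stdAddChar (c * k) * 𝓕 Φ k := by
  rw [dft_apply, dft_apply, Finset.mul_sum]
  refine Fintype.sum_equiv (Equiv.addRight c) _ _ fun j => ?_
  rw [Equiv.coe_addRight, smul_eq_mul, smul_eq_mul, ← mul_assoc, ← AddChar.map_add_eq_mul]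
  congr 2
  ring

/-- The Fourier multiplier of a window of length `n` is a geometric sum of modulus
`|sin(naθ)|/sin(aθ)`, where `θ = π/M` and `a` represents `k`. As `1 ≤ a ≤ M - 1`, the angle `aθ`
lies in `[θ, π - θ]`, where the sine estimate applies. -/
lemma norm_sum_stdAddChar_le {M n : ℕ} [NeZero M] (hn : 0 < n) (hnM : 2 * n ≤ M) {k : ZMod M}
    (hk : k ≠ 0) :
    ‖∑ t ∈ Finset.range n, (ZMod.stdAddChar ((t : ZMod M) * k) : ℂ)‖
      ≤ Real.sin (n * (Real.pi / M)) / Real.sin (Real.pi / M) := by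
  have hpi := Real.pi_pos
  have hM : (0 : ℝ) < M := by exact_mod_cast NeZero.pos M
  have hM2 : (2 : ℝ) ≤ M := by exact_mod_cast (by omega : 2 ≤ M)
  have hnM' : (2 : ℝ) * n ≤ M := by exact_mod_cast hnM
  set θ := Real.pi / M with hθ
  set a := k.val with ha
  have hMθ : M * θ = Real.pi := by rw [hθ]; field_simp
  have hθ0 : 0 < θ := by positivity
  have ha1 : (1 : ℝ) ≤ a := by
    have : a ≠ 0 := by rwa [ha, Ne, ZMod.val_eq_zero]
    exact_mod_cast Nat.one_le_iff_ne_zero.2 this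
  have ha2 : (a : ℝ) + 1 ≤ M := by exact_mod_cast ZMod.val_lt k
  set z : ℂ := Complex.exp (Complex.I * ((2 * (a * θ) : ℝ) : ℂ)) with hz
  have hpow : ∀ t : ℕ, (ZMod.stdAddChar ((t : ZMod M) * k) : ℂ) = z ^ t := by
    intro t
    have h1 : (ZMod.stdAddChar k : ℂ) = z := by
      have h0 : (((a : ℕ) : ℤ) : ZMod M) = k := by rw [ha]; simp
      conv_lhs => rw [← h0]
      rw [ZMod.stdAddChar_coe, hz]
      congr 1
      rw [hθ]
      push_cast
      ring
    rw [← nsmul_eq_mul, AddChar.map_nsmul_eq_pow, h1]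
  have hzn : ∀ t : ℕ, ‖z ^ t - 1‖ = 2 * |Real.sin (t * (a * θ))| := by
    intro t
    have : z ^ t = Complex.exp (Complex.I * ((2 * (t * (a * θ)) : ℝ) : ℂ)) := by
      rw [hz, ← Complex.exp_nat_mul]
      congr 1
      push_cast
      ring
    rw [this, Complex.norm_exp_I_mul_ofReal_sub_one, norm_mul, Real.norm_eq_abs, Real.norm_eq_abs,
      abs_two]
    congr 3
    ring
  have hs : 0 < Real.sin θ := Real.sin_pos_of_pos_of_lt_pi hθ0 (by nlinarith)
  have hsa : 0 < Real.sin (a * θ) :=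
    Real.sin_pos_of_pos_of_lt_pi (by positivity) (by nlinarith)
  have hz1 := hzn 1
  rw [pow_one, Nat.cast_one, one_mul, abs_of_pos hsa] at hz1
  simp_rw [hpow]
  have hgeo : ‖∑ t ∈ Finset.range n, z ^ t‖ * ‖z - 1‖ = ‖z ^ n - 1‖ := by
    rw [← norm_mul, geom_sum_mul]
  rw [hz1, hzn] at hgeo
  have hmain := abs_sin_mul_mul_sin_le (x := a * θ) hθ0 (by nlinarith) (by nlinarith) n hn
    (by nlinarith)
  rw [le_div_iff₀ hs]
  refine le_of_mul_le_mul_right ?_ hsa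
  nlinarith

-- A window sum multiplies each Fourier coefficient by a number; the sum-zero hypothesis removes
-- frequency `0`, the only one where the multiplier is large.
open ZMod in
lemma sum_moving_sum_sq_le_zmod {M n : ℕ} [NeZero M] (hn : 0 < n) (hnM : 2 * n ≤ M)
    (u : ZMod M → ℝ) (hu : ∑ p, u p = 0) :
    ∑ p, (∑ t ∈ Finset.range n, u (p + t)) ^ 2
      ≤ (Real.sin (n * (Real.pi / M)) / Real.sin (Real.pi / M)) ^ 2 * ∑ p, u p ^ 2 := by
  have hM : (0 : ℝ) < M := by exact_mod_cast NeZero.pos M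
  set κ := Real.sin (n * (Real.pi / M)) / Real.sin (Real.pi / M)
  set Φ : ZMod M → ℂ := fun p => (u p : ℂ) with hΦ
  set Ψ : ZMod M → ℂ := ∑ t ∈ Finset.range n, fun p => Φ (p + t) with hΨ
  have hΨ1 : ∀ k, 𝓕 Ψ k = (∑ t ∈ Finset.range n, (stdAddChar ((t : ZMod M) * k) : ℂ)) * 𝓕 Φ k := by
    intro k
    rw [hΨ, map_sum, Finset.sum_apply, Finset.sum_mul]
    exact Finset.sum_congr rfl fun t _ => dft_comp_add_right Φ t k
  have h0 : 𝓕 Φ 0 = 0 := by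
    rw [dft_apply_zero, hΦ]
    change ∑ j, (u j : ℂ) = 0
    exact_mod_cast hu
  have hk : ∀ k, ‖𝓕 Ψ k‖ ^ 2 ≤ κ ^ 2 * ‖𝓕 Φ k‖ ^ 2 := by
    intro k
    by_cases hk : k = 0
    · subst hk
      rw [hΨ1, h0]
      simp
    · rw [hΨ1, norm_mul, mul_pow]
      gcongr
      exact norm_sum_stdAddChar_le hn hnM hk
  have hsum := Finset.sum_le_sum fun k (_ : k ∈ (Finset.univ : Finset (ZMod M))) => hk k
  rw [← Finset.mul_sum, sum_norm_sq_dft, sum_norm_sq_dft, mul_left_comm] at hsum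
  have hres := le_of_mul_le_mul_left hsum hM
  have e1 : ∀ p, ‖Ψ p‖ ^ 2 = (∑ t ∈ Finset.range n, u (p + t)) ^ 2 := by
    intro p
    have : Ψ p = ((∑ t ∈ Finset.range n, u (p + t) : ℝ) : ℂ) := by
      rw [hΨ, Finset.sum_apply]
      push_cast
      rfl
    rw [this, Complex.norm_real, Real.norm_eq_abs, sq_abs]
  have e2 : ∀ p, ‖Φ p‖ ^ 2 = u p ^ 2 := by
    intro p
    rw [hΦ, Complex.norm_real, Real.norm_eq_abs, sq_abs]
  simpa only [e1, e2] using hres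

/-! ### Sums over ranges -/

lemma sum_range_mul_eq (F : ℕ → ℝ) (a b : ℕ) :
    ∑ i ∈ Finset.range (a * b), F i
      = ∑ p ∈ Finset.range a, ∑ t ∈ Finset.range b, F (b * p + t) := by
  induction a with
  | zero => simp
  | succ a ih => rw [add_one_mul, Finset.sum_range_add, ih, Finset.sum_range_succ, mul_comm b a]

lemma sum_range_mul_of_periodic {F : ℕ → ℝ} {b : ℕ} (hF : Function.Periodic F b) (a : ℕ) :
    ∑ i ∈ Finset.range (a * b), F i = a * ∑ t ∈ Finset.range b, F t := by
  rw [sum_range_mul_eq]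
  have : ∀ p t, F (b * p + t) = F t := by
    intro p t
    rw [add_comm, mul_comm]
    exact hF.nat_mul p t
  simp [this]

lemma sum_range_two_mul_of_reflect {F : ℕ → ℝ} {n : ℕ}
    (hF : ∀ i < n, F (2 * n - 1 - i) = F i) :
    ∑ i ∈ Finset.range (2 * n), F i = 2 * ∑ i ∈ Finset.range n, F i := by
  rw [two_mul n, Finset.sum_range_add, two_mul (∑ i ∈ Finset.range n, F i),
    ← Finset.sum_range_reflect (fun i => F (n + i))]
  congr 1
  refine Finset.sum_congr rfl fun i hi => ?_
  have := Finset.mem_range.1 hi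
  rw [← hF i this]
  congr 1
  omega

lemma sum_range_eq_sum_zmod {M : ℕ} [NeZero M] (F : ℕ → ℝ) :
    ∑ i ∈ Finset.range M, F i = ∑ p : ZMod M, F p.val := by
  refine (Finset.sum_bij (fun (p : ZMod M) _ => p.val) ?_ ?_ ?_ ?_).symm
  · intro p _
    exact Finset.mem_range.2 (ZMod.val_lt p)
  · intro p _ q _ h
    exact ZMod.val_injective M h
  · intro i hi
    exact ⟨(i : ZMod M), Finset.mem_univ _, ZMod.val_cast_of_lt (Finset.mem_range.1 hi)⟩
  · intro p _
    rfl

lemma Function.Periodic.eq_of_natCast_eq {F : ℕ → ℝ} {M : ℕ} (hF : Function.Periodic F M)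
    {a b : ℕ} (h : (a : ZMod M) = b) : F a = F b := by
  rw [← hF.map_mod_nat a, ← hF.map_mod_nat b, (ZMod.natCast_eq_natCast_iff' a b M).1 h]

lemma sum_range_comp_affine {F : ℕ → ℝ} {M : ℕ} [NeZero M] (hF : Function.Periodic F M) {a : ℕ}
    (ha : a.Coprime M) (c : ℕ) :
    ∑ i ∈ Finset.range M, F (a * i + c) = ∑ i ∈ Finset.range M, F i := by
  rw [sum_range_eq_sum_zmod, sum_range_eq_sum_zmod]
  refine Fintype.sum_bijective (fun p : ZMod M => a * p + c) ?_ _ _ fun p => ?_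
  · refine Finite.injective_iff_bijective.1 fun p q h => ?_
    exact ((ZMod.isUnit_iff_coprime a M).2 ha).mul_left_cancel (add_right_cancel h)
  · apply hF.eq_of_natCast_eq
    simp

lemma sum_moving_sum_sq_le {M n : ℕ} [NeZero M] (hn : 0 < n) (hnM : 2 * n ≤ M)
    {u : ℕ → ℝ} (hper : Function.Periodic u M) (hu : ∑ p ∈ Finset.range M, u p = 0) :
    ∑ p ∈ Finset.range M, (∑ t ∈ Finset.range n, u (p + t)) ^ 2
      ≤ (Real.sin (n * (Real.pi / M)) / Real.sin (Real.pi / M)) ^ 2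
        * ∑ p ∈ Finset.range M, u p ^ 2 := by
  rw [sum_range_eq_sum_zmod] at hu
  have := sum_moving_sum_sq_le_zmod hn hnM (fun p => u p.val) hu
  rw [sum_range_eq_sum_zmod, sum_range_eq_sum_zmod (fun p => u p ^ 2)]
  refine le_of_eq_of_le (Finset.sum_congr rfl fun p _ => ?_) this
  congr 1
  refine Finset.sum_congr rfl fun t _ => ?_
  apply hper.eq_of_natCast_eq
  simp

/-! ### The zigzag on mesh cells -/

/-- The index of the cell of mesh `1 / L` onto which the zigzag map sends the cell of index `q` of
the refined mesh. -/
def zigzagFold (L q : ℕ) : ℕ :=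
  if Even (q / L) then q % L else L - 1 - q % L

lemma zigzagFold_lt {L : ℕ} (hL : 0 < L) (q : ℕ) : zigzagFold L q < L := by
  have := Nat.mod_lt q hL
  unfold zigzagFold
  split_ifs <;> omega

lemma zigzagFold_mul_add {L t : ℕ} (j : ℕ) (ht : t < L) :
    zigzagFold L (L * j + t) = if Even j then t else L - 1 - t := by
  have hL : 0 < L := by omega
  rw [zigzagFold, Nat.mul_add_div hL, Nat.mul_add_mod, Nat.div_eq_of_lt ht, Nat.mod_eq_of_lt ht,
    add_zero]

lemma zigzagFold_periodic (L : ℕ) : Function.Periodic (zigzagFold L) (2 * L) := by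
  intro q
  rcases Nat.eq_zero_or_pos L with rfl | hL
  · simp
  have h : q + 2 * L = L * (q / L + 2) + q % L := by
    have := Nat.div_add_mod q L
    rw [mul_add]
    omega
  rw [h, zigzagFold_mul_add _ (Nat.mod_lt q hL), zigzagFold]
  simp [Nat.even_add]

/-- The fold is even as well as periodic. The reflection is allowed over `k` periods because the
windows `m i + r` with `i < 2N` run through `m` of them. -/
lemma zigzagFold_reflect {L : ℕ} (k : ℕ) {q : ℕ} (hq : q < 2 * L * k) :
    zigzagFold L (2 * L * k - 1 - q) = zigzagFold L q := by
  have hL : 0 < L := by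
    rcases Nat.eq_zero_or_pos L with rfl | hL
    · simp at hq
    · exact hL
  have ht := Nat.mod_lt q hL
  have hdm := Nat.div_add_mod q L
  have hj : q / L < 2 * k := by
    rw [Nat.div_lt_iff_lt_mul hL]
    calc q < 2 * L * k := hq
      _ = 2 * k * L := by ring
  obtain ⟨c, hc⟩ := Nat.exists_eq_add_of_lt hj
  have h : 2 * L * k - 1 - q = L * c + (L - 1 - q % L) := by
    have : 2 * L * k = L * (q / L) + L * c + L := by
      calc 2 * L * k = L * (2 * k) := by ring
        _ = _ := by rw [hc]; ring
    omega
  rw [h, zigzagFold_mul_add _ (by omega), zigzagFold]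
  have hpar : Even (q / L) ↔ ¬ Even c := by
    have : Even (q / L + c + 1) := ⟨k, by omega⟩
    grind
  by_cases he : Even c
  · rw [if_pos he, if_neg (by tauto)]
  · rw [if_neg he, if_pos (by tauto)]
    omega

lemma sum_comp_zigzagFold (v : ℕ → ℝ) (N a : ℕ) :
    ∑ q ∈ Finset.range (a * N), v (zigzagFold N q) = a * ∑ i ∈ Finset.range N, v i := by
  rw [sum_range_mul_eq]
  have : ∀ p, ∑ t ∈ Finset.range N, v (zigzagFold N (N * p + t)) = ∑ i ∈ Finset.range N, v i := by
    intro p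
    by_cases hp : Even p
    · refine Finset.sum_congr rfl fun t ht => ?_
      rw [zigzagFold_mul_add p (Finset.mem_range.1 ht), if_pos hp]
    · rw [← Finset.sum_range_reflect v]
      refine Finset.sum_congr rfl fun t ht => ?_
      rw [zigzagFold_mul_add p (Finset.mem_range.1 ht), if_neg hp]
  simp [this]

/-- The second singular value of the transfer operator of the `m`-fold zigzag map on mesh
functions. -/
noncomputable def zigzagRate (m N : ℕ) : ℝ :=
  (Nat.gcd m (2 * N) : ℝ) * Real.sin (m * Real.pi / (2 * N)) /
    (m * Real.sin ((Nat.gcd m (2 * N) : ℝ) * Real.pi / (2 * N)))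

lemma mul_zigzagRate {m N d n M : ℕ} (hd : d = Nat.gcd m (2 * N)) (hd0 : 0 < d) (hn0 : 0 < n)
    (hM0 : 0 < M) (hn : m = d * n) (hM : 2 * N = d * M) :
    m * zigzagRate m N = d * (Real.sin (n * (Real.pi / M)) / Real.sin (Real.pi / M)) := by
  have hm' : (m : ℝ) ≠ 0 := by
    rw [hn]
    positivity
  have h2N : (2 * N : ℝ) = d * M := by exact_mod_cast hM
  have e1 : (m : ℝ) * Real.pi / (2 * N) = n * (Real.pi / M) := by
    rw [h2N, show (m : ℝ) = d * n by exact_mod_cast hn]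
    field_simp
  have e2 : (d : ℝ) * Real.pi / (2 * N) = Real.pi / M := by
    rw [h2N]
    field_simp
  rw [zigzagRate, ← hd, e1, e2]
  field_simp

/-- The norm bound on the zigzag matrix, up to the normalisation `1/m`. Cauchy–Schwarz on blocks of
length `d` and the Fourier bound on `ZMod M` are the only losses; both are equalities for the
extremal cosine. -/
lemma sum_zigzagFold_sq_le {m N : ℕ} (hm : 2 ≤ m) (hN : m < N) (v : ℕ → ℝ)
    (hv : ∑ i ∈ Finset.range N, v i = 0) :
    ∑ i ∈ Finset.range N, (∑ r ∈ Finset.range m, v (zigzagFold N (m * i + r))) ^ 2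
      ≤ (m * zigzagRate m N) ^ 2 * ∑ i ∈ Finset.range N, v i ^ 2 := by
  set d := Nat.gcd m (2 * N) with hd
  have hd0 : 0 < d := Nat.gcd_pos_of_pos_left _ (by omega)
  obtain ⟨n, hn⟩ : d ∣ m := Nat.gcd_dvd_left _ _
  obtain ⟨M, hM⟩ : d ∣ 2 * N := Nat.gcd_dvd_right _ _
  have hcop : n.Coprime M := by
    refine Nat.eq_of_mul_eq_mul_left hd0 ?_
    rw [← Nat.gcd_mul_left, ← hn, ← hM, mul_one]
  have hM0 : 0 < M := Nat.pos_of_ne_zero (by rintro rfl; omega)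
  have hn0 : 0 < n := Nat.pos_of_ne_zero (by rintro rfl; omega)
  have : NeZero M := ⟨hM0.ne'⟩
  have hnM : 2 * n ≤ M := by
    refine Nat.le_of_mul_le_mul_left ?_ hd0
    calc d * (2 * n) = 2 * m := by rw [hn]; ring
      _ ≤ d * M := by omega
  set V : ℕ → ℝ := fun q => v (zigzagFold N q) with hV
  have hVper : Function.Periodic V (2 * N) := fun q => by simp only [hV, zigzagFold_periodic N q]
  have hVsq : ∑ q ∈ Finset.range (M * d), V q ^ 2 = 2 * ∑ i ∈ Finset.range N, v i ^ 2 := by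
    rw [mul_comm M d, ← hM]
    simpa using sum_comp_zigzagFold (fun i => v i ^ (2 : ℕ)) N 2
  set U : ℕ → ℝ := fun p => ∑ t ∈ Finset.range d, V (d * p + t) with hU
  have hUper : Function.Periodic U M := by
    intro p
    refine Finset.sum_congr rfl fun t _ => ?_
    rw [← hVper (d * p + t), hM]
    congr 1
    ring
  have hU0 : ∑ p ∈ Finset.range M, U p = 0 := by
    rw [hU, ← sum_range_mul_eq V M d, mul_comm M d, ← hM, hV, sum_comp_zigzagFold, hv, mul_zero]
  have hUsq : ∑ p ∈ Finset.range M, U p ^ 2 ≤ d * (2 * ∑ i ∈ Finset.range N, v i ^ 2) := by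
    rw [← hVsq, sum_range_mul_eq, Finset.mul_sum]
    refine Finset.sum_le_sum fun p _ => ?_
    simpa using sq_sum_le_card_mul_sum_sq (s := Finset.range d) (f := fun t => V (d * p + t))
  set W : ℕ → ℝ := fun i => ∑ r ∈ Finset.range m, V (m * i + r) with hW
  have hWU : ∀ i, W i = ∑ t ∈ Finset.range n, U (n * i + t) := by
    intro i
    simp only [hW, hU]
    rw [hn, mul_comm d n, sum_range_mul_eq (fun r => V (n * d * i + r))]
    refine Finset.sum_congr rfl fun p _ => Finset.sum_congr rfl fun t _ => ?_
    congr 1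
    ring
  -- Reflection exchanges window `i` with window `2N - 1 - i`, so the sum over `i < N` is half of
  -- that over a full period `2N`.
  have hWrefl : ∀ i < N, W (2 * N - 1 - i) ^ 2 = W i ^ 2 := by
    intro i hi
    congr 1
    simp only [hW]
    rw [← Finset.sum_range_reflect]
    refine Finset.sum_congr rfl fun r hr => ?_
    have hr := Finset.mem_range.1 hr
    have hlt : m * i + r < 2 * N * m := by nlinarith
    simp only [hV]
    rw [← zigzagFold_reflect m hlt]
    congr 2
    obtain ⟨e, he⟩ : ∃ e, 2 * N = i + 1 + e := ⟨2 * N - (i + 1), by omega⟩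
    have h1 : 2 * N - 1 - i = e := by omega
    have h2 : 2 * N * m = m * i + m + m * e := by rw [he]; ring
    rw [h1, h2]
    omega
  have hWper : Function.Periodic (fun i => W i ^ 2) M := by
    intro i
    simp only [hWU]
    congr 1
    refine Finset.sum_congr rfl fun t _ => ?_
    have : n * (i + M) + t = n * i + t + n * M := by ring
    rw [this]
    exact hUper.nat_mul n _
  have hmov := sum_moving_sum_sq_le hn0 hnM hUper hU0
  set κ := Real.sin (n * (Real.pi / M)) / Real.sin (Real.pi / M) with hκ
  have hrate : m * zigzagRate m N = d * κ := mul_zigzagRate hd hd0 hn0 hM0 hn hM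
  -- The range `2N` consists of `d` periods of length `M`, and on each of them `i ↦ n i` permutes
  -- the residues because `n` and `M` are coprime.
  have hsumW : 2 * ∑ i ∈ Finset.range N, W i ^ 2
      = d * ∑ p ∈ Finset.range M, (∑ t ∈ Finset.range n, U (p + t)) ^ 2 := by
    rw [← sum_range_two_mul_of_reflect hWrefl, hM, sum_range_mul_of_periodic hWper]
    congr 1
    simp only [hWU]
    refine sum_range_comp_affine (F := fun p => (∑ t ∈ Finset.range n, U (p + t)) ^ 2) ?_ hcop 0
    intro p
    simp only
    congr 1
    refine Finset.sum_congr rfl fun t _ => ?_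
    rw [add_right_comm]
    exact hUper _
  rw [hrate]
  change ∑ i ∈ Finset.range N, W i ^ 2 ≤ _
  have hfin : 2 * ∑ i ∈ Finset.range N, W i ^ 2
      ≤ d * (κ ^ 2 * (d * (2 * ∑ i ∈ Finset.range N, v i ^ 2))) := by
    rw [hsumW]
    gcongr
    exact hmov.trans (by gcongr)
  linarith

/-- Equivalently `1/m ≤ s`: errors that shrink with the mesh, like `m^(-n)`, never dominate `s^n`.
It also yields positivity of the rate. -/
lemma one_le_mul_zigzagRate {m N : ℕ} (hm : 2 ≤ m) (hN : m < N) : 1 ≤ m * zigzagRate m N := by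
  have hpi := Real.pi_pos
  set d := Nat.gcd m (2 * N) with hd
  have hd0 : 0 < d := Nat.gcd_pos_of_pos_left _ (by omega)
  have hdm : d ≤ m := Nat.gcd_le_left _ (by omega)
  have hN0 : (0 : ℝ) < N := by exact_mod_cast (by omega : 0 < N)
  have hm0 : (0 : ℝ) < m := by exact_mod_cast (by omega : 0 < m)
  have hd0' : (1 : ℝ) ≤ d := by exact_mod_cast hd0
  have hdm' : (d : ℝ) ≤ m := by exact_mod_cast hdm
  have hmN : (m : ℝ) ≤ N := by exact_mod_cast hN.le
  have h0 : 0 < (d : ℝ) * Real.pi / (2 * N) := by positivity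
  have h1 : (d : ℝ) * Real.pi / (2 * N) ≤ m * Real.pi / (2 * N) := by gcongr
  have h2 : (m : ℝ) * Real.pi / (2 * N) ≤ Real.pi / 2 := by
    rw [div_le_div_iff₀ (by positivity) (by positivity)]
    nlinarith
  have hs : 0 < Real.sin (d * Real.pi / (2 * N)) :=
    Real.sin_pos_of_pos_of_lt_pi h0 (by linarith)
  have hss := Real.sin_le_sin_of_le_of_le_pi_div_two (by linarith) h2 h1
  have : m * zigzagRate m N
      = d * (Real.sin (m * Real.pi / (2 * N)) / Real.sin (d * Real.pi / (2 * N))) := by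
    rw [zigzagRate, ← hd]
    field_simp
  rw [this]
  exact one_le_mul_of_one_le_of_one_le hd0' ((one_le_div hs).2 hss)

/-! ### Integrals over mesh cells -/

/-- The integral over the cell of index `q` of the mesh of size `1 / L`. -/
noncomputable def cellIntegral (L q : ℕ) (Φ : ℝ → ℝ) : ℝ :=
  ∫ x in ((q : ℝ) / L)..(((q : ℝ) + 1) / L), Φ x

/-- A permutation of `Fin N` as a function on natural numbers. -/
def permIndex {N : ℕ} (σ : Equiv.Perm (Fin N)) (p : ℕ) : ℕ :=
  if h : p < N then σ ⟨p, h⟩ else p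

lemma permIndex_lt {N : ℕ} (σ : Equiv.Perm (Fin N)) {p : ℕ} (hp : p < N) : permIndex σ p < N := by
  rw [permIndex, dif_pos hp]
  exact (σ _).2

lemma permIndex_fin {N : ℕ} (σ : Equiv.Perm (Fin N)) (i : Fin N) : permIndex σ i = σ i := by
  rw [permIndex, dif_pos i.2]

lemma sum_comp_permIndex {N : ℕ} (σ : Equiv.Perm (Fin N)) (v : ℕ → ℝ) :
    ∑ i ∈ Finset.range N, v (permIndex σ i) = ∑ i ∈ Finset.range N, v i := by
  rw [Finset.sum_range, Finset.sum_range]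
  simp only [permIndex_fin]
  exact Equiv.sum_comp σ fun i => v i

lemma zigzag_apply (m : ℕ) (x : ℝ) :
    zigzag m x = if Even ⌊(m : ℝ) * x⌋₊ then m * x - (⌊(m : ℝ) * x⌋₊ : ℝ)
      else (⌊(m : ℝ) * x⌋₊ : ℝ) + 1 - m * x := by
  unfold zigzag branchMap
  simp only [Nat.add_sub_cancel, neg_one_pow_eq_one_iff_even (show (-1 : ℤˣ) ≠ 1 by decide)]
  split_ifs <;> push_cast <;> ring

/-- Each cell of the mesh `1/(mL)` lies in a single branch, number `q / L`, which is affine of slope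
`±m` and maps it onto one cell of the mesh `1/L`. Only open cells are compared, so values at break
points play no role. -/
lemma cellIntegral_comp_zigzag {m L : ℕ} (hm : 0 < m) (hL : 0 < L) (q : ℕ) (Φ : ℝ → ℝ) :
    cellIntegral (m * L) q (Φ ∘ zigzag m) = (1 / m) * cellIntegral L (zigzagFold L q) Φ := by
  have hm' : (0 : ℝ) < m := by exact_mod_cast hm
  have hL' : (0 : ℝ) < L := by exact_mod_cast hL
  set j := q / L with hj
  set t := q % L with ht
  have htL : t < L := Nat.mod_lt q hL
  have htL' : (t : ℝ) + 1 ≤ L := by exact_mod_cast htL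
  have hq : (q : ℝ) = L * j + t := by exact_mod_cast (Nat.div_add_mod q L).symm
  have hle : (q : ℝ) / ((m * L : ℕ) : ℝ) ≤ ((q : ℝ) + 1) / ((m * L : ℕ) : ℝ) := by
    gcongr
    linarith
  have hfloor : ∀ x ∈ Ioo ((q : ℝ) / ((m * L : ℕ) : ℝ)) (((q : ℝ) + 1) / ((m * L : ℕ) : ℝ)),
      ⌊(m : ℝ) * x⌋₊ = j := by
    rintro x ⟨h1, h2⟩
    push_cast at h1 h2
    rw [div_lt_iff₀ (by positivity)] at h1
    rw [lt_div_iff₀ (by positivity)] at h2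
    have hx0 : 0 ≤ (m : ℝ) * x := by
      refine nonneg_of_mul_nonneg_left (b := (L : ℝ)) ?_ hL'
      have : (0 : ℝ) ≤ q := by positivity
      nlinarith
    rw [Nat.floor_eq_iff hx0]
    constructor
    · refine le_of_mul_le_mul_right (a := (L : ℝ)) ?_ hL'
      have : (0 : ℝ) ≤ t := by positivity
      nlinarith
    · refine lt_of_mul_lt_mul_right (a := (L : ℝ)) ?_ hL'.le
      nlinarith
  by_cases he : Even j
  · have hcongr : cellIntegral (m * L) q (Φ ∘ zigzag m)
        = ∫ x in ((q : ℝ) / ((m * L : ℕ) : ℝ))..(((q : ℝ) + 1) / ((m * L : ℕ) : ℝ)),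
          Φ (m * x - j) := by
      refine intervalIntegral.integral_congr_Ioo_of_le hle fun x hx => ?_
      simp only [Function.comp_apply]
      rw [zigzag_apply, hfloor x hx, if_pos he]
    rw [hcongr, intervalIntegral.integral_comp_mul_sub Φ hm'.ne', smul_eq_mul, one_div,
      zigzagFold, ← hj, if_pos he, ← ht, cellIntegral, hq]
    congr 2 <;> (push_cast; field_simp; ring)
  · have hcongr : cellIntegral (m * L) q (Φ ∘ zigzag m)
        = ∫ x in ((q : ℝ) / ((m * L : ℕ) : ℝ))..(((q : ℝ) + 1) / ((m * L : ℕ) : ℝ)),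
          Φ (j + 1 - m * x) := by
      refine intervalIntegral.integral_congr_Ioo_of_le hle fun x hx => ?_
      simp only [Function.comp_apply]
      rw [zigzag_apply, hfloor x hx, if_neg he]
    have hc : ((L - 1 - t : ℕ) : ℝ) = L - 1 - t := by
      rw [Nat.cast_sub (by omega), Nat.cast_sub (by omega)]
      simp
    rw [hcongr, intervalIntegral.integral_comp_sub_mul Φ hm'.ne', smul_eq_mul, one_div,
      zigzagFold, ← hj, if_neg he, ← ht, cellIntegral, hq, hc]
    congr 2 <;> (push_cast; field_simp; ring)

/-- On a refinement by `K`, the exchange translates blocks of `K` cells: the block `p / K` moves and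
the position `p % K` inside it is kept. -/
lemma cellIntegral_comp_intervalExchange {N K : ℕ} (hK : 0 < K) (σ : Equiv.Perm (Fin N)) {p : ℕ}
    (hp : p < N * K) (Φ : ℝ → ℝ) :
    cellIntegral (N * K) p (Φ ∘ intervalExchange N σ)
      = cellIntegral (N * K) (K * permIndex σ (p / K) + p % K) Φ := by
  have hN : 0 < N := Nat.pos_of_ne_zero (by rintro rfl; simp at hp)
  have hN' : (0 : ℝ) < N := by exact_mod_cast hN
  have hK' : (0 : ℝ) < K := by exact_mod_cast hK
  set j := p / K with hj
  set t := p % K with ht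
  have hjN : j < N := by rwa [hj, Nat.div_lt_iff_lt_mul hK]
  have htK : t < K := Nat.mod_lt p hK
  have htK' : (t : ℝ) + 1 ≤ K := by exact_mod_cast htK
  have hq : (p : ℝ) = K * j + t := by exact_mod_cast (Nat.div_add_mod p K).symm
  have hle : (p : ℝ) / ((N * K : ℕ) : ℝ) ≤ ((p : ℝ) + 1) / ((N * K : ℕ) : ℝ) := by
    gcongr
    linarith
  have hcongr : cellIntegral (N * K) p (Φ ∘ intervalExchange N σ)
      = ∫ x in ((p : ℝ) / ((N * K : ℕ) : ℝ))..(((p : ℝ) + 1) / ((N * K : ℕ) : ℝ)),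
          Φ (x + ((permIndex σ j : ℝ) - j) / N) := by
    refine intervalIntegral.integral_congr_Ioo_of_le hle ?_
    rintro x ⟨h1, h2⟩
    push_cast at h1 h2
    rw [div_lt_iff₀ (by positivity)] at h1
    rw [lt_div_iff₀ (by positivity)] at h2
    have hx0 : 0 ≤ (N : ℝ) * x := by
      refine nonneg_of_mul_nonneg_left (b := (K : ℝ)) ?_ hK'
      have : (0 : ℝ) ≤ p := by positivity
      nlinarith
    have hfl : ⌊(N : ℝ) * x⌋₊ = j := by
      rw [Nat.floor_eq_iff hx0]
      constructor
      · refine le_of_mul_le_mul_right (a := (K : ℝ)) ?_ hK'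
        have : (0 : ℝ) ≤ t := by positivity
        nlinarith
      · refine lt_of_mul_lt_mul_right (a := (K : ℝ)) ?_ hK'.le
        nlinarith
    simp only [Function.comp_apply, intervalExchange, hfl, hjN, permIndex, dif_pos]
  rw [hcongr, intervalIntegral.integral_comp_add_right, cellIntegral, hq]
  congr 1 <;> (push_cast; field_simp; ring)

lemma mul_permIndex_add_mod_lt {N K : ℕ} (hK : 0 < K) (σ : Equiv.Perm (Fin N)) {p : ℕ}
    (hp : p < N * K) : K * permIndex σ (p / K) + p % K < N * K := by
  have h1 : permIndex σ (p / K) < N := permIndex_lt σ (by rwa [Nat.div_lt_iff_lt_mul hK])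
  have h2 := Nat.mod_lt p hK
  nlinarith

lemma cellIntegral_comp_comp {m N K : ℕ} (hm : 0 < m) (hK : 0 < K) (hN : 0 < N)
    (σ : Equiv.Perm (Fin N)) (q : ℕ) (Φ : ℝ → ℝ) :
    cellIntegral (m * (N * K)) q (Φ ∘ (intervalExchange N σ ∘ zigzag m))
      = (1 / m) * cellIntegral (N * K) (K * permIndex σ (zigzagFold (N * K) q / K)
          + zigzagFold (N * K) q % K) Φ := by
  rw [← Function.comp_assoc, cellIntegral_comp_zigzag hm (by positivity),
    cellIntegral_comp_intervalExchange hK σ (zigzagFold_lt (by positivity) q)]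

lemma cellIntegral_mesh_comp {m N : ℕ} (hm : 0 < m) (hN : 0 < N)
    (σ : Equiv.Perm (Fin N)) (q : ℕ) (Φ : ℝ → ℝ) :
    cellIntegral (m * N) q (Φ ∘ (intervalExchange N σ ∘ zigzag m))
      = (1 / m) * cellIntegral N (permIndex σ (zigzagFold N q)) Φ := by
  simpa [Nat.mod_one] using cellIntegral_comp_comp hm one_pos hN σ q Φ

lemma sum_cellIntegral {Φ : ℝ → ℝ} (hΦ : ∀ a b, IntervalIntegrable Φ volume a b) {L : ℕ}
    (hL : 0 < L) : ∑ q ∈ Finset.range L, cellIntegral L q Φ = ∫ x in (0 : ℝ)..1, Φ x := by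
  have := intervalIntegral.sum_integral_adjacent_intervals (f := Φ) (μ := volume)
    (a := fun q : ℕ => (q : ℝ) / L) (n := L) fun k _ => hΦ _ _
  have hL' : (L : ℝ) ≠ 0 := by positivity
  simpa [cellIntegral, hL'] using this

lemma cellIntegral_eq_sum {Φ : ℝ → ℝ} (hΦ : ∀ a b, IntervalIntegrable Φ volume a b) {m L : ℕ}
    (hm : 0 < m) (hL : 0 < L) (p : ℕ) :
    cellIntegral L p Φ = ∑ r ∈ Finset.range m, cellIntegral (m * L) (m * p + r) Φ := by
  have := intervalIntegral.sum_integral_adjacent_intervals (f := Φ) (μ := volume)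
    (a := fun r : ℕ => ((m * p + r : ℕ) : ℝ) / ((m * L : ℕ) : ℝ)) (n := m) fun k _ => hΦ _ _
  have hL' : (0 : ℝ) < L := by positivity
  have hm' : (0 : ℝ) < m := by positivity
  have e : (m * p : ℝ) / (m * L) = p / L := by field_simp
  have e' : (m * p + m : ℝ) / (m * L) = (p + 1) / L := by field_simp
  simp only [Nat.cast_add, Nat.cast_mul, add_zero, e, e', Nat.cast_one] at this
  rw [cellIntegral, ← this]
  refine Finset.sum_congr rfl fun r _ => ?_
  rw [cellIntegral]
  push_cast
  rw [add_assoc]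

/-! ### Decay of the mesh averages -/

/-- The composition of an interval exchange with the zigzag map. -/
noncomputable def permutedZigzag (m : ℕ) {N : ℕ} (σ : Equiv.Perm (Fin N)) : ℝ → ℝ :=
  intervalExchange N σ ∘ zigzag m

lemma measurable_zigzag (m : ℕ) : Measurable (zigzag m) := by
  have h : zigzag m = fun x => if Even ⌊(m : ℝ) * x⌋₊ then m * x - (⌊(m : ℝ) * x⌋₊ : ℝ)
      else (⌊(m : ℝ) * x⌋₊ : ℝ) + 1 - m * x := funext (zigzag_apply m)
  have hf : Measurable fun x : ℝ => ⌊(m : ℝ) * x⌋₊ :=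
    Nat.measurable_floor.comp (measurable_const_mul _)
  have hf' : Measurable fun x : ℝ => (⌊(m : ℝ) * x⌋₊ : ℝ) := measurable_from_nat.comp hf
  rw [h]
  refine Measurable.ite ?_ (by fun_prop) (by fun_prop)
  exact hf (MeasurableSet.of_discrete (s := {n | Even n}))

lemma measurable_intervalExchange {N : ℕ} (σ : Equiv.Perm (Fin N)) :
    Measurable (intervalExchange N σ) := by
  have h : intervalExchange N σ = fun x => if ⌊(N : ℝ) * x⌋₊ < N then
      x + ((permIndex σ ⌊(N : ℝ) * x⌋₊ : ℝ) - (⌊(N : ℝ) * x⌋₊ : ℝ)) / N else x := by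
    funext x
    unfold intervalExchange
    split_ifs with h <;> simp [permIndex, h]
  have hf : Measurable fun x : ℝ => ⌊(N : ℝ) * x⌋₊ :=
    Nat.measurable_floor.comp (measurable_const_mul _)
  have hf' : Measurable fun x : ℝ => (⌊(N : ℝ) * x⌋₊ : ℝ) := measurable_from_nat.comp hf
  have hp : Measurable fun x : ℝ => (permIndex σ ⌊(N : ℝ) * x⌋₊ : ℝ) :=
    (measurable_from_nat (f := fun n => (permIndex σ n : ℝ))).comp hf
  rw [h]
  refine Measurable.ite ?_ (by fun_prop) (by fun_prop)
  exact hf (MeasurableSet.of_discrete (s := {n | n < N}))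

lemma measurable_permutedZigzag (m : ℕ) {N : ℕ} (σ : Equiv.Perm (Fin N)) :
    Measurable (permutedZigzag m σ) :=
  (measurable_intervalExchange σ).comp (measurable_zigzag m)

lemma zigzag_mem_Icc (m : ℕ) {x : ℝ} (hx : x ∈ Icc (0 : ℝ) 1) : zigzag m x ∈ Icc (0 : ℝ) 1 := by
  have h0 : 0 ≤ (m : ℝ) * x := mul_nonneg (by positivity) hx.1
  have h1 := Nat.floor_le h0
  have h2 := Nat.lt_floor_add_one ((m : ℝ) * x)
  rw [zigzag_apply]
  split_ifs <;> constructor <;> linarith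

lemma intervalExchange_mem_Icc {N : ℕ} (σ : Equiv.Perm (Fin N)) {x : ℝ}
    (hx : x ∈ Icc (0 : ℝ) 1) : intervalExchange N σ x ∈ Icc (0 : ℝ) 1 := by
  unfold intervalExchange
  split_ifs with h
  · have hN : (0 : ℝ) < N := by exact_mod_cast (by omega : 0 < N)
    have h1 := Nat.floor_le (mul_nonneg hN.le hx.1)
    have h2 := Nat.lt_floor_add_one ((N : ℝ) * x)
    generalize σ ⟨⌊(N : ℝ) * x⌋₊, h⟩ = i
    have h3 : ((i : ℕ) : ℝ) + 1 ≤ N := by exact_mod_cast i.2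
    have h4 : (0 : ℝ) ≤ ((i : ℕ) : ℝ) := by positivity
    have e : x + (((i : ℕ) : ℝ) - (⌊(N : ℝ) * x⌋₊ : ℝ)) / N
        = (N * x + (((i : ℕ) : ℝ) - (⌊(N : ℝ) * x⌋₊ : ℝ))) / N := by
      field_simp
    rw [e]
    constructor
    · apply div_nonneg _ hN.le
      linarith
    · rw [div_le_one hN]
      linarith
  · exact hx

lemma iterate_permutedZigzag_mem_Icc (m : ℕ) {N : ℕ} (σ : Equiv.Perm (Fin N)) (n : ℕ) {x : ℝ}
    (hx : x ∈ Icc (0 : ℝ) 1) : (permutedZigzag m σ)^[n] x ∈ Icc (0 : ℝ) 1 := by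
  have h : MapsTo (permutedZigzag m σ) (Icc 0 1) (Icc 0 1) := fun y hy =>
    intervalExchange_mem_Icc σ (zigzag_mem_Icc m hy)
  exact h.iterate n hx

lemma intervalIntegrable_of_measurable_of_bounded {Φ : ℝ → ℝ} (hΦ : Measurable Φ) {K : ℝ}
    (hK : ∀ x, |Φ x| ≤ K) (a b : ℝ) : IntervalIntegrable Φ volume a b :=
  (intervalIntegrable_const (c := K)).mono_fun' hΦ.aestronglyMeasurable
    (ae_of_all _ fun x => hK x)

section Averages

variable {m N : ℕ} {σ : Equiv.Perm (Fin N)} {φ : ℝ → ℝ} {K : ℝ}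

lemma cellIntegral_iterate_succ (hm : 0 < m) (hN : 0 < N) (hφ : Measurable φ)
    (hK : ∀ x, |φ x| ≤ K) (n i : ℕ) :
    cellIntegral N i (φ ∘ (permutedZigzag m σ)^[n + 1])
      = (1 / m) * ∑ r ∈ Finset.range m, cellIntegral N
          (permIndex σ (zigzagFold N (m * i + r))) (φ ∘ (permutedZigzag m σ)^[n]) := by
  have hint : ∀ a b, IntervalIntegrable (φ ∘ (permutedZigzag m σ)^[n + 1]) volume a b :=
    intervalIntegrable_of_measurable_of_bounded
      (hφ.comp ((measurable_permutedZigzag m σ).iterate _)) fun x => hK _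
  rw [cellIntegral_eq_sum hint hm hN, Finset.mul_sum]
  refine Finset.sum_congr rfl fun r _ => ?_
  rw [Function.iterate_succ, ← Function.comp_assoc]
  exact cellIntegral_mesh_comp hm hN σ _ _

lemma sum_cellIntegral_iterate (hm : 0 < m) (hN : 0 < N) (hφ : Measurable φ)
    (hK : ∀ x, |φ x| ≤ K) (n : ℕ) :
    ∑ i ∈ Finset.range N, cellIntegral N i (φ ∘ (permutedZigzag m σ)^[n])
      = ∑ i ∈ Finset.range N, cellIntegral N i φ := by
  induction n with
  | zero => rfl
  | succ n ih =>
    rw [← ih]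
    simp only [cellIntegral_iterate_succ hm hN hφ hK]
    rw [← Finset.mul_sum, ← sum_range_mul_eq (fun q => cellIntegral N
      (permIndex σ (zigzagFold N q)) (φ ∘ (permutedZigzag m σ)^[n])) N m, mul_comm N m,
      sum_comp_zigzagFold (fun i => cellIntegral N
      (permIndex σ i) (φ ∘ (permutedZigzag m σ)^[n])),
      sum_comp_permIndex σ (fun i => cellIntegral N i (φ ∘ (permutedZigzag m σ)^[n]))]
    have : (m : ℝ) ≠ 0 := by positivity
    field_simp

lemma sum_cellIntegral_iterate_sq_le (hm : 2 ≤ m) (hN : m < N) (hφ : Measurable φ)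
    (hK : ∀ x, |φ x| ≤ K) (h0 : ∑ i ∈ Finset.range N, cellIntegral N i φ = 0) (n : ℕ) :
    ∑ i ∈ Finset.range N, cellIntegral N i (φ ∘ (permutedZigzag m σ)^[n]) ^ 2
      ≤ (zigzagRate m N ^ n) ^ 2 * ∑ i ∈ Finset.range N, cellIntegral N i φ ^ 2 := by
  have hm0 : 0 < m := by omega
  have hN0 : 0 < N := by omega
  induction n with
  | zero => simp
  | succ n ih =>
    set b : ℕ → ℝ := fun i => cellIntegral N i (φ ∘ (permutedZigzag m σ)^[n]) with hb
    have hz : ∑ i ∈ Finset.range N, b (permIndex σ i) = 0 := by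
      rw [sum_comp_permIndex, ← h0, ← sum_cellIntegral_iterate hm0 hN0 hφ hK n]
    have hm' : (0 : ℝ) < m := by positivity
    simp only [cellIntegral_iterate_succ hm0 hN0 hφ hK, mul_pow (1 / (m : ℝ))]
    rw [← Finset.mul_sum]
    calc (1 / (m : ℝ)) ^ 2 * ∑ i ∈ Finset.range N,
          (∑ r ∈ Finset.range m, b (permIndex σ (zigzagFold N (m * i + r)))) ^ 2
        ≤ (1 / (m : ℝ)) ^ 2 * ((m * zigzagRate m N) ^ 2
            * ∑ i ∈ Finset.range N, b (permIndex σ i) ^ 2) := by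
          gcongr
          exact sum_zigzagFold_sq_le hm hN (fun i => b (permIndex σ i)) hz
      _ = zigzagRate m N ^ 2 * ∑ i ∈ Finset.range N, b i ^ 2 := by
          rw [sum_comp_permIndex σ fun i => b i ^ 2]
          field_simp
      _ ≤ zigzagRate m N ^ 2 * ((zigzagRate m N ^ n) ^ 2
            * ∑ i ∈ Finset.range N, cellIntegral N i φ ^ 2) := by
          gcongr
      _ = _ := by ring

lemma zigzagRate_pos (hm : 2 ≤ m) (hN : m < N) : 0 < zigzagRate m N := by
  have h := one_le_mul_zigzagRate hm hN
  have hm' : (0 : ℝ) < m := by positivity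
  exact pos_of_mul_pos_right (by linarith) hm'.le

lemma abs_cellIntegral_iterate_le (hm : 2 ≤ m) (hN : m < N) (hφ : Measurable φ)
    (hK : ∀ x, |φ x| ≤ K) (h0 : ∑ i ∈ Finset.range N, cellIntegral N i φ = 0) (n : ℕ) {i : ℕ}
    (hi : i < N) :
    |cellIntegral N i (φ ∘ (permutedZigzag m σ)^[n])|
      ≤ √(∑ i ∈ Finset.range N, cellIntegral N i φ ^ 2) * zigzagRate m N ^ n := by
  have hs := (zigzagRate_pos hm hN).le
  refine abs_le_of_sq_le_sq ?_ (by positivity)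
  rw [mul_pow, Real.sq_sqrt (Finset.sum_nonneg fun i _ => sq_nonneg _), mul_comm]
  exact (Finset.single_le_sum (f := fun i => cellIntegral N i (φ ∘ (permutedZigzag m σ)^[n]) ^ 2)
    (fun i _ => sq_nonneg _) (Finset.mem_range.2 hi)).trans
    (sum_cellIntegral_iterate_sq_le hm hN hφ hK h0 n)

/-- Every application of `g` takes a cell of the mesh `1/(N m^(k+1))` affinely onto one of the mesh
`1/(N m^k)`, with a factor `1/m`. After `k` of them a cell of the base mesh is reached, and the `ℓ²`
decay applies to the remaining `n` iterations. -/
lemma abs_cellIntegral_refined_iterate_le (hm : 2 ≤ m) (hN : m < N) (hφ : Measurable φ)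
    (hK : ∀ x, |φ x| ≤ K) (h0 : ∑ i ∈ Finset.range N, cellIntegral N i φ = 0) (n k : ℕ) {q : ℕ}
    (hq : q < N * m ^ k) :
    |cellIntegral (N * m ^ k) q (φ ∘ (permutedZigzag m σ)^[n + k])|
      ≤ (1 / m) ^ k * (√(∑ i ∈ Finset.range N, cellIntegral N i φ ^ 2) * zigzagRate m N ^ n) := by
  have hm0 : 0 < m := by omega
  induction k generalizing q with
  | zero => simpa using abs_cellIntegral_iterate_le hm hN hφ hK h0 n (by simpa using hq)
  | succ k ih =>
    have e : N * m ^ (k + 1) = m * (N * m ^ k) := by ring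
    have hp : 0 < m ^ k := by positivity
    have hNk : 0 < N * m ^ k := Nat.mul_pos (by omega) hp
    rw [e, ← add_assoc, Function.iterate_succ, ← Function.comp_assoc]
    have := cellIntegral_comp_comp hm0 hp (by omega) σ q
      (φ ∘ (permutedZigzag m σ)^[n + k])
    rw [permutedZigzag] at this ⊢
    rw [this, abs_mul, abs_of_nonneg (by positivity), pow_succ', mul_assoc]
    gcongr
    exact ih (mul_permIndex_add_mod_lt hp σ (zigzagFold_lt hNk q))

end Averages

/-! ### Upper bound for the mixing rate -/

section UpperBound

variable {m N : ℕ} {σ : Equiv.Perm (Fin N)} {φ : ℝ → ℝ} {K : ℝ}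

lemma sum_mesh_sub {ψ : ℝ → ℝ} {L : ℕ} (hL : 0 < L) :
    ∑ p ∈ Finset.range L, (ψ (((p : ℝ) + 1) / L) - ψ ((p : ℝ) / L)) = ψ 1 - ψ 0 := by
  have := Finset.sum_range_sub (fun p : ℕ => ψ ((p : ℝ) / L)) L
  have hL' : (L : ℝ) ≠ 0 := by positivity
  simpa [hL'] using this

lemma Monotone.intervalIntegrable_bdd_mul {Φ ψ : ℝ → ℝ} (hψ : Monotone ψ) (hΦ : Measurable Φ)
    (hK : ∀ x, |Φ x| ≤ K) (a b : ℝ) : IntervalIntegrable (fun x => Φ x * ψ x) volume a b := by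
  have h : IntervalIntegrable ψ volume a b := hψ.intervalIntegrable
  exact ⟨Integrable.bdd_mul h.1 hΦ.aestronglyMeasurable (ae_of_all _ hK),
    Integrable.bdd_mul h.2 hΦ.aestronglyMeasurable (ae_of_all _ hK)⟩

/-- On each cell the error is at most `K/L` times the increment of `ψ`; by monotonicity these
increments telescope. -/
lemma abs_integral_sub_sum_cellIntegral_le {Φ ψ : ℝ → ℝ} (hΦ : Measurable Φ)
    (hK : ∀ x, |Φ x| ≤ K) (hψ : Monotone ψ) {L : ℕ} (hL : 0 < L) :
    |(∫ x in (0 : ℝ)..1, Φ x * ψ x)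
        - ∑ q ∈ Finset.range L, ψ ((q : ℝ) / L) * cellIntegral L q Φ|
      ≤ K * (ψ 1 - ψ 0) / L := by
  have hL' : (0 : ℝ) < L := by positivity
  have hint := intervalIntegrable_of_measurable_of_bounded hΦ hK
  have hK0 : 0 ≤ K := (abs_nonneg _).trans (hK 0)
  have hprod : ∀ a b, IntervalIntegrable (fun x => Φ x * ψ x) volume a b := fun a b =>
    hψ.intervalIntegrable_bdd_mul hΦ hK a b
  rw [← sum_cellIntegral hprod hL, ← Finset.sum_sub_distrib]
  have hcell : ∀ q ∈ Finset.range L,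
      |cellIntegral L q (fun x => Φ x * ψ x) - ψ ((q : ℝ) / L) * cellIntegral L q Φ|
        ≤ (K / L) * (ψ (((q : ℝ) + 1) / L) - ψ ((q : ℝ) / L)) := by
    intro q _
    have hle : (q : ℝ) / L ≤ ((q : ℝ) + 1) / L := by
      gcongr
      linarith
    rw [cellIntegral, cellIntegral, ← intervalIntegral.integral_const_mul,
      ← intervalIntegral.integral_sub (hprod _ _) ((hint _ _).const_mul _), ← Real.norm_eq_abs]
    refine (intervalIntegral.norm_integral_le_of_norm_le_const
      (C := K * (ψ (((q : ℝ) + 1) / L) - ψ ((q : ℝ) / L))) ?_).trans_eq ?_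
    · intro x hx
      rw [uIoc_of_le hle] at hx
      have h1 := hψ hx.1.le
      have h2 := hψ hx.2
      rw [mul_comm (ψ _), ← mul_sub, norm_mul, Real.norm_eq_abs, Real.norm_eq_abs,
        abs_of_nonneg (sub_nonneg.2 h1)]
      gcongr
      exact hK x
    · rw [← sub_div, add_sub_cancel_left, abs_of_pos (by positivity)]
      ring
  refine (Finset.abs_sum_le_sum_abs _ _).trans ((Finset.sum_le_sum hcell).trans_eq ?_)
  rw [← Finset.mul_sum, sum_mesh_sub hL]
  ring

/-- On each of the `m` subcells, the sampled value of `ψ` changes by at most its increment over the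
coarse cell; the increments telescope again. -/
lemma abs_sum_cellIntegral_refine_le {Φ ψ : ℝ → ℝ} (hΦ : Measurable Φ)
    (hK : ∀ x, |Φ x| ≤ K) (hψ : Monotone ψ) {L : ℕ} (hL : 0 < L) (hm : 0 < m) {B : ℝ}
    (hB : ∀ q < m * L, |cellIntegral (m * L) q Φ| ≤ B) :
    |∑ q ∈ Finset.range (m * L), ψ ((q : ℝ) / (m * L : ℕ)) * cellIntegral (m * L) q Φ
        - ∑ p ∈ Finset.range L, ψ ((p : ℝ) / L) * cellIntegral L p Φ|
      ≤ m * B * (ψ 1 - ψ 0) := by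
  have hL' : (0 : ℝ) < L := by positivity
  have hm' : (0 : ℝ) < m := by positivity
  have hint := intervalIntegrable_of_measurable_of_bounded hΦ hK
  have hB0 : 0 ≤ B := (abs_nonneg _).trans (hB 0 (by positivity))
  rw [mul_comm m L, sum_range_mul_eq, ← Finset.sum_sub_distrib, mul_comm L m]
  have hcell : ∀ p ∈ Finset.range L,
      |∑ r ∈ Finset.range m, ψ (((m * p + r : ℕ) : ℝ) / (m * L : ℕ))
          * cellIntegral (m * L) (m * p + r) Φ - ψ ((p : ℝ) / L) * cellIntegral L p Φ|
        ≤ m * B * (ψ (((p : ℝ) + 1) / L) - ψ ((p : ℝ) / L)) := by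
    intro p hp
    rw [cellIntegral_eq_sum hint hm hL, Finset.mul_sum, ← Finset.sum_sub_distrib]
    have hterm : ∀ r ∈ Finset.range m,
        |ψ (((m * p + r : ℕ) : ℝ) / (m * L : ℕ)) * cellIntegral (m * L) (m * p + r) Φ
          - ψ ((p : ℝ) / L) * cellIntegral (m * L) (m * p + r) Φ|
          ≤ (ψ (((p : ℝ) + 1) / L) - ψ ((p : ℝ) / L)) * B := by
      intro r hr
      have hr := Finset.mem_range.1 hr
      have hp := Finset.mem_range.1 hp
      have hr' : (r : ℝ) ≤ m := by exact_mod_cast hr.le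
      have h1 : (p : ℝ) / L ≤ ((m * p + r : ℕ) : ℝ) / (m * L : ℕ) := by
        push_cast
        rw [div_le_div_iff₀ hL' (by positivity)]
        have : (0 : ℝ) ≤ r * L := by positivity
        nlinarith
      have h2 : ((m * p + r : ℕ) : ℝ) / (m * L : ℕ) ≤ ((p : ℝ) + 1) / L := by
        push_cast
        rw [div_le_div_iff₀ (by positivity) hL']
        have : (r : ℝ) * L ≤ m * L := by gcongr
        nlinarith
      have h3 := hψ h1
      have h4 := hψ h2
      rw [← sub_mul, abs_mul, abs_of_nonneg (sub_nonneg.2 h3)]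
      refine mul_le_mul (by linarith) (hB _ (by nlinarith)) (abs_nonneg _) (by linarith)
    refine (Finset.abs_sum_le_sum_abs _ _).trans ((Finset.sum_le_sum hterm).trans_eq ?_)
    rw [Finset.sum_const, Finset.card_range, nsmul_eq_mul]
    ring
  refine (Finset.abs_sum_le_sum_abs _ _).trans ((Finset.sum_le_sum hcell).trans_eq ?_)
  rw [← Finset.mul_sum, sum_mesh_sub hL]

/-- The integral is compared with sums `S k` sampling `ψ` on the mesh `1/(N m^k)`, for `k` from `0`
to `n`. The gain `m^(-k)` from the size of the cells makes up for the `k` iterations lost in the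
decay of the cell integrals, so every refinement costs the same multiple of `s^n`. -/
lemma exists_abs_integral_iterate_mul_le (hm : 2 ≤ m) (hN : m < N) (hφ : Measurable φ)
    (hK : ∀ x, |φ x| ≤ K) (h0 : ∫ x in (0 : ℝ)..1, φ x = 0) {ψ : ℝ → ℝ} (hψ : Monotone ψ) :
    ∃ C, ∀ n : ℕ, |∫ x in (0 : ℝ)..1, φ ((permutedZigzag m σ)^[n] x) * ψ x|
      ≤ C * ((n + 1) * zigzagRate m N ^ n) := by
  have hm0 : 0 < m := by omega
  have hN0 : 0 < N := by omega
  have hm' : (0 : ℝ) < m := by positivity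
  have hN' : (0 : ℝ) < N := by positivity
  have hs := zigzagRate_pos hm hN
  have hms : 1 / m ≤ zigzagRate m N := by
    rw [div_le_iff₀ hm', mul_comm]
    exact one_le_mul_zigzagRate hm hN
  have hK0 : 0 ≤ K := (abs_nonneg _).trans (hK 0)
  have hV : 0 ≤ ψ 1 - ψ 0 := sub_nonneg.2 (hψ zero_le_one)
  rw [← sum_cellIntegral (intervalIntegrable_of_measurable_of_bounded hφ hK) hN0] at h0
  set s := zigzagRate m N with hsdef
  set A := √(∑ i ∈ Finset.range N, cellIntegral N i φ ^ 2) with hA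
  set V := ψ 1 - ψ 0 with hVdef
  have hA0 : 0 ≤ A := Real.sqrt_nonneg _
  -- The three terms bound the coarse sum `S 0`, one refinement step (of which there are `n`), and
  -- the sampling error on the finest mesh.
  refine ⟨N * ((|ψ 0| + |ψ 1|) * A) + A * V / s + K * V / N, fun n => ?_⟩
  set Φ := φ ∘ (permutedZigzag m σ)^[n] with hΦdef
  have hΦ : Measurable Φ := hφ.comp ((measurable_permutedZigzag m σ).iterate _)
  have hΦK : ∀ x, |Φ x| ≤ K := fun x => hK _
  have hcell : ∀ k ≤ n, ∀ q < N * m ^ k,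
      |cellIntegral (N * m ^ k) q Φ| ≤ (1 / m) ^ k * (A * s ^ (n - k)) := by
    intro k hk q hq
    have := abs_cellIntegral_refined_iterate_le (σ := σ) hm hN hφ hK h0 (n - k) k hq
    rwa [Nat.sub_add_cancel hk] at this
  set S : ℕ → ℝ := fun k => ∑ q ∈ Finset.range (N * m ^ k),
    ψ ((q : ℝ) / (N * m ^ k : ℕ)) * cellIntegral (N * m ^ k) q Φ with hS
  have hS0 : |S 0| ≤ N * ((|ψ 0| + |ψ 1|) * A) * s ^ n := by
    have hterm : ∀ q ∈ Finset.range (N * m ^ 0),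
        |ψ ((q : ℝ) / (N * m ^ 0 : ℕ)) * cellIntegral (N * m ^ 0) q Φ|
          ≤ (|ψ 0| + |ψ 1|) * (A * s ^ n) := by
      intro q hq
      have hq := Finset.mem_range.1 hq
      have h1 := hcell 0 (Nat.zero_le n) q hq
      rw [pow_zero (M := ℕ), mul_one] at hq
      have hq' : (q : ℝ) ≤ N := by exact_mod_cast hq.le
      rw [pow_zero (M := ℝ), one_mul, Nat.sub_zero] at h1
      rw [abs_mul]
      refine mul_le_mul ?_ h1 (abs_nonneg _) (by positivity)
      have h2 : ψ 0 ≤ ψ ((q : ℝ) / (N * m ^ 0 : ℕ)) := hψ (by positivity)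
      have h3 : ψ ((q : ℝ) / (N * m ^ 0 : ℕ)) ≤ ψ 1 := by
        refine hψ ?_
        rw [pow_zero, mul_one]
        exact (div_le_one hN').2 hq'
      rw [abs_le]
      constructor
      · linarith [neg_abs_le (ψ 0), abs_nonneg (ψ 1)]
      · linarith [le_abs_self (ψ 1), abs_nonneg (ψ 0)]
    refine (Finset.abs_sum_le_sum_abs _ _).trans ((Finset.sum_le_sum hterm).trans_eq ?_)
    rw [Finset.sum_const, Finset.card_range, nsmul_eq_mul, pow_zero, mul_one]
    ring
  have hSstep : ∀ k < n, |S (k + 1) - S k| ≤ A * V / s * s ^ n := by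
    intro k hk
    have e : N * m ^ (k + 1) = m * (N * m ^ k) := by ring
    have := abs_sum_cellIntegral_refine_le hΦ hΦK hψ (L := N * m ^ k) (by positivity) hm0
      (B := (1 / m) ^ (k + 1) * (A * s ^ (n - (k + 1)))) (by
        rw [← e]
        exact hcell (k + 1) hk)
    rw [← e] at this
    refine this.trans ?_
    calc m * ((1 / m) ^ (k + 1) * (A * s ^ (n - (k + 1)))) * V
        = (1 / m) ^ k * (A * V * s ^ (n - (k + 1))) := by
          rw [pow_succ]
          field_simp
      _ ≤ s ^ k * (A * V * s ^ (n - (k + 1))) := by gcongr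
      _ = A * V / s * s ^ n := by
          obtain ⟨l, hl⟩ := Nat.exists_eq_add_of_lt hk
          have : n - (k + 1) = l := by omega
          rw [this, hl, pow_succ, pow_add]
          field_simp
  have hSk : ∀ k ≤ n, |S k - S 0| ≤ k * (A * V / s * s ^ n) := by
    intro k
    induction k with
    | zero => simp
    | succ k ih =>
      intro hk
      have h1 := ih (by omega)
      have h2 := hSstep k (by omega)
      have h3 := abs_sub_le (S (k + 1)) (S k) (S 0)
      push_cast
      linarith
  have hlast := abs_integral_sub_sum_cellIntegral_le hΦ hΦK hψ (L := N * m ^ n) (by positivity)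
  have hlast' : |(∫ x in (0 : ℝ)..1, Φ x * ψ x) - S n| ≤ K * V / N * s ^ n := by
    refine hlast.trans ?_
    calc K * V / (N * m ^ n : ℕ) = K * V / N * (1 / m) ^ n := by
          push_cast
          rw [one_div, inv_pow]
          field_simp
      _ ≤ K * V / N * s ^ n := by gcongr
  have h1 := hSk n le_rfl
  have htri : |∫ x in (0 : ℝ)..1, Φ x * ψ x|
      ≤ |(∫ x in (0 : ℝ)..1, Φ x * ψ x) - S n| + |S n - S 0| + |S 0| := by
    have := abs_add_three ((∫ x in (0 : ℝ)..1, Φ x * ψ x) - S n) (S n - S 0) (S 0)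
    simpa using this
  change |∫ x in (0 : ℝ)..1, Φ x * ψ x| ≤ _
  have hn : (0 : ℝ) ≤ n := by positivity
  have p1 : 0 ≤ N * ((|ψ 0| + |ψ 1|) * A) * s ^ n := by positivity
  have p2 : 0 ≤ A * V / s * s ^ n := by positivity
  have p3 : 0 ≤ K * V / N * s ^ n := by positivity
  nlinarith [mul_nonneg hn p1, mul_nonneg hn p3]

/-- Jordan decomposition, precomposed with the clamp onto `[0, 1]` so that both parts are monotone
on the whole line and their difference is bounded. -/
lemma BoundedVariationOn.exists_monotone_sub {f : ℝ → ℝ} (hf : BoundedVariationOn f (Icc 0 1)) :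
    ∃ p q : ℝ → ℝ, Monotone p ∧ Monotone q ∧ (∃ K, ∀ x, |p x - q x| ≤ K) ∧
      ∀ x ∈ Icc (0 : ℝ) 1, f x = p x - q x := by
  obtain ⟨p, q, hp, hq, rfl⟩ :=
    hf.locallyBoundedVariationOn.exists_monotoneOn_sub_monotoneOn
  set c : ℝ → ℝ := fun x => max 0 (min 1 x) with hc
  have hc1 : ∀ x, c x ∈ Icc (0 : ℝ) 1 := fun x =>
    ⟨le_max_left _ _, max_le zero_le_one (min_le_left _ _)⟩
  have hc2 : Monotone c := fun x y h => max_le_max le_rfl (min_le_min le_rfl h)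
  have z : (0 : ℝ) ∈ Icc (0 : ℝ) 1 := ⟨le_rfl, zero_le_one⟩
  have o : (1 : ℝ) ∈ Icc (0 : ℝ) 1 := ⟨zero_le_one, le_rfl⟩
  refine ⟨p ∘ c, q ∘ c, fun x y h => hp (hc1 x) (hc1 y) (hc2 h),
    fun x y h => hq (hc1 x) (hc1 y) (hc2 h),
    ⟨|p 0| + |p 1| + |q 0| + |q 1|, fun x => ?_⟩, fun x hx => ?_⟩
  · have h1 := hp z (hc1 x) (hc1 x).1
    have h2 := hp (hc1 x) o (hc1 x).2
    have h3 := hq z (hc1 x) (hc1 x).1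
    have h4 := hq (hc1 x) o (hc1 x).2
    simp only [Function.comp_apply]
    rw [abs_le]
    constructor <;>
    linarith [neg_abs_le (p 0), neg_abs_le (q 0), le_abs_self (p 1), le_abs_self (q 1),
      abs_nonneg (p 1), abs_nonneg (p 0), abs_nonneg (q 1), abs_nonneg (q 0)]
  · have : c x = x := by
      simp only [hc]
      rw [min_eq_right hx.2, max_eq_right hx.1]
    simp [this]

lemma integral_restrict_Icc_zero_one {f h : ℝ → ℝ} (hfh : ∀ x ∈ Icc (0 : ℝ) 1, f x = h x) :
    ∫ x, f x ∂(volume.restrict (Icc (0 : ℝ) 1)) = ∫ x in (0 : ℝ)..1, h x := by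
  rw [setIntegral_congr_fun measurableSet_Icc hfh, integral_Icc_eq_integral_Ioc,
    intervalIntegral.integral_of_le zero_le_one]

lemma correlation_isBigO (hm : 2 ≤ m) (hN : m < N) {τ : ℝ} (hτ : zigzagRate m N < τ)
    {φ ψ : ℝ → ℝ} (hφ : BoundedVariationOn φ (Icc 0 1)) (hψ : BoundedVariationOn ψ (Icc 0 1)) :
    (fun n => correlation (volume.restrict (Icc 0 1)) (permutedZigzag m σ) φ ψ n)
      =O[atTop] fun n : ℕ => τ ^ n := by
  obtain ⟨p, q, hp, hq, ⟨K, hK⟩, hpq⟩ := hφ.exists_monotone_sub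
  obtain ⟨a, b, ha, hb, -, hab⟩ := hψ.exists_monotone_sub
  have hs := zigzagRate_pos hm hN
  set c := ∫ x in (0 : ℝ)..1, (p x - q x) with hc
  -- Removing the mean leaves the correlation unchanged and gives the zero-integral hypothesis of
  -- the decay estimate.
  set φ₀ : ℝ → ℝ := fun x => p x - q x - c with hφ₀
  have hφm : Measurable φ₀ := (hp.measurable.sub hq.measurable).sub_const c
  have hφK : ∀ x, |φ₀ x| ≤ K + |c| := fun x => (abs_sub _ _).trans (by linarith [hK x])
  have hpqi : IntervalIntegrable (fun x => p x - q x) volume 0 1 :=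
    hp.intervalIntegrable.sub hq.intervalIntegrable
  have hφ0 : ∫ x in (0 : ℝ)..1, φ₀ x = 0 := by
    rw [hφ₀, intervalIntegral.integral_sub hpqi intervalIntegrable_const]
    simp [hc]
  have hai : IntervalIntegrable a volume 0 1 := ha.intervalIntegrable
  have hbi : IntervalIntegrable b volume 0 1 := hb.intervalIntegrable
  obtain ⟨C₁, hC₁⟩ := exists_abs_integral_iterate_mul_le (σ := σ) hm hN hφm hφK hφ0 ha
  obtain ⟨C₂, hC₂⟩ := exists_abs_integral_iterate_mul_le (σ := σ) hm hN hφm hφK hφ0 hb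
  have hcorr : ∀ n, correlation (volume.restrict (Icc 0 1)) (permutedZigzag m σ) φ ψ n
      = (∫ x in (0 : ℝ)..1, φ₀ ((permutedZigzag m σ)^[n] x) * a x)
        - ∫ x in (0 : ℝ)..1, φ₀ ((permutedZigzag m σ)^[n] x) * b x := by
    intro n
    have hΦ : Measurable (fun x => φ₀ ((permutedZigzag m σ)^[n] x)) :=
      hφm.comp ((measurable_permutedZigzag m σ).iterate _)
    have i1 : IntervalIntegrable (fun x => φ₀ ((permutedZigzag m σ)^[n] x) * a x) volume 0 1 :=
      ha.intervalIntegrable_bdd_mul hΦ (fun x => hφK _) 0 1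
    have i2 : IntervalIntegrable (fun x => φ₀ ((permutedZigzag m σ)^[n] x) * b x) volume 0 1 :=
      hb.intervalIntegrable_bdd_mul hΦ (fun x => hφK _) 0 1
    have e : ∀ x ∈ Icc (0 : ℝ) 1, φ ((permutedZigzag m σ)^[n] x) * ψ x
        = (φ₀ ((permutedZigzag m σ)^[n] x) * a x - φ₀ ((permutedZigzag m σ)^[n] x) * b x)
          + c * (a x - b x) := by
      intro x hx
      rw [hpq _ (iterate_permutedZigzag_mem_Icc m σ n hx), hab x hx]
      simp only [hφ₀]
      ring
    rw [correlation, integral_restrict_Icc_zero_one e, integral_restrict_Icc_zero_one hpq,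
      integral_restrict_Icc_zero_one hab, intervalIntegral.integral_add (i1.sub i2)
      ((hai.sub hbi).const_mul c), intervalIntegral.integral_sub i1 i2,
      intervalIntegral.integral_const_mul, ← hc]
    ring
  have hbig : (fun n => correlation (volume.restrict (Icc 0 1)) (permutedZigzag m σ) φ ψ n)
      =O[atTop] fun n : ℕ => ((n : ℝ) + 1) * zigzagRate m N ^ n := by
    refine IsBigO.of_bound (C₁ + C₂) (Eventually.of_forall fun n => ?_)
    rw [hcorr, Real.norm_eq_abs, Real.norm_eq_abs,
      abs_of_nonneg (a := ((n : ℝ) + 1) * zigzagRate m N ^ n) (by positivity)]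
    refine (abs_sub _ _).trans ?_
    linarith [hC₁ n, hC₂ n]
  refine hbig.trans ?_
  have hlt : ‖zigzagRate m N‖ < τ := by rwa [Real.norm_eq_abs, abs_of_pos hs]
  have h1 := (isLittleO_pow_const_mul_const_pow_const_pow_of_norm_lt (R := ℝ) 1 hlt).isBigO
  have h2 := (isLittleO_pow_const_mul_const_pow_const_pow_of_norm_lt (R := ℝ) 0 hlt).isBigO
  simp only [pow_one, pow_zero, one_mul] at h1 h2
  simpa only [add_mul, one_mul] using h1.add h2

lemma mixingRate_permutedZigzag_le (hm : 2 ≤ m) (hN : m < N) (σ : Equiv.Perm (Fin N)) :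
    mixingRate (volume.restrict (Icc 0 1)) (permutedZigzag m σ) ≤ zigzagRate m N := by
  have hs := zigzagRate_pos hm hN
  -- Because of the factor `n + 1`, the decay is only established for `τ` strictly above the rate;
  -- this suffices for an infimum.
  refine le_of_forall_gt_imp_ge_of_dense fun τ hτ => ?_
  refine csInf_le ⟨0, fun x hx => hx.1⟩ ⟨(hs.trans hτ).le, fun φ ψ hφ hψ => ?_⟩
  exact correlation_isBigO hm hN hτ hφ hψ

end UpperBound

/-! ### A permutation attaining the bound -/

lemma sum_cos_mul_sin (θ : ℝ) (a n : ℕ) :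
    (∑ p ∈ Finset.range n, Real.cos ((2 * ((a + p : ℕ) : ℝ) + 1) * θ)) * Real.sin θ
      = Real.cos ((2 * a + n) * θ) * Real.sin (n * θ) := by
  have h : (∑ p ∈ Finset.range n, Real.cos ((2 * ((a + p : ℕ) : ℝ) + 1) * θ)) * (2 * Real.sin θ)
      = Real.sin (2 * (a + n) * θ) - Real.sin (2 * a * θ) := by
    induction n with
    | zero => simp
    | succ n ih =>
      rw [Finset.sum_range_succ, add_mul, ih]
      have e1 : 2 * ((a : ℝ) + (n + 1 : ℕ)) * θ = (2 * ((a + n : ℕ) : ℝ) + 1) * θ + θ := by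
        push_cast
        ring
      have e2 : 2 * ((a : ℝ) + n) * θ = (2 * ((a + n : ℕ) : ℝ) + 1) * θ - θ := by
        push_cast
        ring
      rw [e1, e2, Real.sin_add, Real.sin_sub]
      ring
  have e1 : 2 * ((a : ℝ) + n) * θ = (2 * a + n) * θ + n * θ := by ring
  have e2 : 2 * (a : ℝ) * θ = (2 * a + n) * θ - n * θ := by ring
  rw [e1, e2, Real.sin_add, Real.sin_sub] at h
  linarith

/-- Folding identifies exactly the indices related by the period and the reflection, so it is
invisible to even periodic sequences. -/
lemma comp_zigzagFold_of_symm {F : ℕ → ℝ} {N : ℕ} (hN : 0 < N)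
    (hper : Function.Periodic F (2 * N)) (hrefl : ∀ i < N, F (2 * N - 1 - i) = F i) (q : ℕ) :
    F (zigzagFold N q) = F q := by
  have ht := Nat.mod_lt q hN
  have hdm := Nat.div_add_mod q N
  rw [zigzagFold]
  rcases Nat.even_or_odd (q / N) with h | h
  · rw [if_pos h]
    obtain ⟨k, hk⟩ := h
    have e : q = q % N + k * (2 * N) := by
      rw [hk] at hdm
      conv_lhs => rw [← hdm]
      ring
    conv_rhs => rw [e]
    exact (hper.nat_mul k _).symm
  · rw [if_neg (Nat.not_even_iff_odd.2 h)]
    obtain ⟨k, hk⟩ := h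
    have e : q = (N + q % N) + k * (2 * N) := by
      rw [hk] at hdm
      conv_lhs => rw [← hdm]
      ring
    conv_rhs => rw [e]
    refine Eq.trans ?_ (hper.nat_mul k _).symm
    rw [← hrefl (N - 1 - q % N) (by omega)]
    congr 1
    omega

/-- Taking `F` to be the indicator of a point shows that corresponding fibres of `f` and `g` have
equal size; bijections between fibres are glued. -/
lemma exists_perm_comp_eq {N : ℕ} {f g : Fin N → ℝ}
    (h : ∀ F : ℝ → ℝ, ∑ i, F (f i) = ∑ i, F (g i)) : ∃ σ : Equiv.Perm (Fin N), ∀ i, f (σ i) = g i := by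
  classical
  have hcard : ∀ c : ℝ, Nonempty ({i // g i = c} ≃ {i // f i = c}) := by
    intro c
    rw [← Fintype.card_eq, Fintype.card_subtype, Fintype.card_subtype]
    have := h fun x => if x = c then 1 else 0
    rw [Finset.sum_boole, Finset.sum_boole] at this
    exact_mod_cast this.symm
  let e := fun c => (hcard c).some
  refine ⟨(Equiv.sigmaFiberEquiv g).symm.trans
    ((Equiv.sigmaCongrRight e).trans (Equiv.sigmaFiberEquiv f)), fun i => ?_⟩
  exact (e (g i) ⟨i, rfl⟩).2

lemma cos_add_two_mul_nat_mul_pi (x : ℝ) (k : ℕ) : Real.cos (x + 2 * k * Real.pi) = Real.cos x := by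
  rw [← Real.cos_add_nat_mul_two_pi x k]
  congr 1
  ring

section Attained

variable {m N d n M : ℕ}

lemma cos_div_periodic (hd0 : 0 < d) (hM0 : 0 < M) :
    Function.Periodic (fun l : ℕ => Real.cos ((2 * ((l / d : ℕ) : ℝ) + 1) * (Real.pi / M)))
      (d * M) := by
  intro l
  have hM' : (M : ℝ) ≠ 0 := by positivity
  simp only
  rw [Nat.add_mul_div_left _ _ hd0]
  refine Eq.trans (congrArg Real.cos ?_) (cos_add_two_mul_nat_mul_pi _ 1)
  push_cast
  field_simp
  ring

lemma cos_div_reflect (hd0 : 0 < d) (hM0 : 0 < M) {l : ℕ} (hl : l < d * M) :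
    Real.cos ((2 * (((d * M - 1 - l) / d : ℕ) : ℝ) + 1) * (Real.pi / M))
      = Real.cos ((2 * ((l / d : ℕ) : ℝ) + 1) * (Real.pi / M)) := by
  have hM' : (M : ℝ) ≠ 0 := by positivity
  have hb := Nat.mod_lt l hd0
  have hdm := Nat.div_add_mod l d
  have ha : l / d < M := by rwa [Nat.div_lt_iff_lt_mul hd0, mul_comm]
  obtain ⟨c, hc⟩ := Nat.exists_eq_add_of_lt ha
  have hdM : d * M = d * (l / d) + d * c + d := by
    conv_lhs => rw [hc]
    ring
  have e : d * M - 1 - l = d * c + (d - 1 - l % d) := by omega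
  have hq : (d * M - 1 - l) / d = c := by
    rw [e, Nat.mul_add_div hd0, Nat.div_eq_of_lt (by omega), add_zero]
  have hc' : (M : ℝ) = ((l / d : ℕ) : ℝ) + c + 1 := by exact_mod_cast hc
  rw [hq, ← Real.cos_two_pi_sub]
  congr 1
  rw [show (c : ℝ) = M - ((l / d : ℕ) : ℝ) - 1 by linarith]
  field_simp
  ring

lemma cos_mul_periodic (hM0 : 0 < M) :
    Function.Periodic (fun i : ℕ => Real.cos ((2 * (i : ℝ) + 1) * (n * (Real.pi / M)))) M := by
  intro i
  have hM' : (M : ℝ) ≠ 0 := by positivity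
  refine Eq.trans (congrArg Real.cos ?_) (cos_add_two_mul_nat_mul_pi _ n)
  push_cast
  field_simp
  ring

lemma cos_mul_reflect (hM0 : 0 < M) {i : ℕ} (hi : i < d * M) :
    Real.cos ((2 * ((d * M - 1 - i : ℕ) : ℝ) + 1) * (n * (Real.pi / M)))
      = Real.cos ((2 * (i : ℝ) + 1) * (n * (Real.pi / M))) := by
  have hM' : (M : ℝ) ≠ 0 := by positivity
  have e : ((d * M - 1 - i : ℕ) : ℝ) = d * M - 1 - i := by
    rw [Nat.cast_sub (by omega), Nat.cast_sub (by omega)]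
    push_cast
    ring
  -- The reflected angle is `2dnπ` minus the original one.
  rw [e, ← Real.cos_neg, ← cos_add_two_mul_nat_mul_pi ((2 * (i : ℝ) + 1) * (n * (Real.pi / M))) 0,
    ← cos_add_two_mul_nat_mul_pi (-_) (d * n)]
  congr 1
  push_cast
  field_simp
  ring

lemma sum_comp_cos_mul (hM0 : 0 < M) (hM : 2 * N = d * M) (F : ℝ → ℝ) :
    2 * ∑ i ∈ Finset.range N, F (Real.cos ((2 * (i : ℝ) + 1) * (n * (Real.pi / M))))
      = d * ∑ i ∈ Finset.range M, F (Real.cos ((2 * (i : ℝ) + 1) * (n * (Real.pi / M)))) := by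
  rw [← sum_range_two_mul_of_reflect
    (F := fun i : ℕ => F (Real.cos ((2 * (i : ℝ) + 1) * (n * (Real.pi / M))))), hM]
  · refine sum_range_mul_of_periodic
      (F := fun i : ℕ => F (Real.cos ((2 * (i : ℝ) + 1) * (n * (Real.pi / M))))) ?_ d
    exact fun i => congrArg F (cos_mul_periodic hM0 i)
  · intro i hi
    rw [hM, cos_mul_reflect hM0 (by omega)]

lemma sum_comp_cos_div (hd0 : 0 < d) (hM0 : 0 < M) (hM : 2 * N = d * M) (F : ℝ → ℝ) :
    2 * ∑ l ∈ Finset.range N, F (Real.cos ((2 * ((l / d : ℕ) : ℝ) + 1) * (Real.pi / M)))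
      = d * ∑ p ∈ Finset.range M, F (Real.cos ((2 * (p : ℝ) + 1) * (Real.pi / M))) := by
  rw [← sum_range_two_mul_of_reflect
    (F := fun l : ℕ => F (Real.cos ((2 * ((l / d : ℕ) : ℝ) + 1) * (Real.pi / M)))), hM,
    mul_comm d M, sum_range_mul_eq, Finset.mul_sum]
  · refine Finset.sum_congr rfl fun p _ => ?_
    have : ∀ t ∈ Finset.range d,
        F (Real.cos ((2 * (((d * p + t) / d : ℕ) : ℝ) + 1) * (Real.pi / M)))
          = F (Real.cos ((2 * (p : ℝ) + 1) * (Real.pi / M))) := by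
      intro t ht
      rw [Nat.mul_add_div hd0, Nat.div_eq_of_lt (Finset.mem_range.1 ht), add_zero]
    rw [Finset.sum_congr rfl this]
    simp
  · intro l hl
    rw [hM, cos_div_reflect hd0 hM0 (by omega)]

/-- For odd `n` the numbers `n(2i + 1)` are odd and hence run through the odd frequencies. For even
`n` they are even, but `M` is then odd and adding `π = M · π/M` makes them odd, at the price of the
sign `-1`. -/
lemma exists_sign_sum_comp_cos (hM0 : 0 < M) (hcop : n.Coprime M) :
    ∃ ε : ℝ, ε * ε = 1 ∧ ∀ F : ℝ → ℝ,
      ∑ i ∈ Finset.range M, F (ε * Real.cos ((2 * (i : ℝ) + 1) * (n * (Real.pi / M))))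
        = ∑ p ∈ Finset.range M, F (Real.cos ((2 * (p : ℝ) + 1) * (Real.pi / M))) := by
  have hM' : (M : ℝ) ≠ 0 := by positivity
  have : NeZero M := ⟨hM0.ne'⟩
  have hper : ∀ F : ℝ → ℝ, Function.Periodic
      (fun p : ℕ => F (Real.cos ((2 * (p : ℝ) + 1) * (Real.pi / M)))) M := by
    intro F p
    have := cos_mul_periodic (n := 1) hM0 p
    simp only [Nat.cast_one, one_mul] at this
    exact congrArg F this
  rcases Nat.even_or_odd n with hn | hn
  · have hMo : Odd M := by
      rw [← Nat.not_even_iff_odd]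
      intro hMe
      have := Nat.dvd_gcd hn.two_dvd hMe.two_dvd
      rw [hcop] at this
      omega
    obtain ⟨c, hc⟩ := hn.add_odd hMo
    refine ⟨-1, by norm_num, fun F => ?_⟩
    rw [← sum_range_comp_affine (hper F) hcop c]
    refine Finset.sum_congr rfl fun i _ => ?_
    rw [neg_one_mul, ← Real.cos_add_pi]
    congr 2
    have hc' : (n : ℝ) + M = 2 * c + 1 := by exact_mod_cast hc
    push_cast
    field_simp
    linear_combination hc'
  · obtain ⟨c, hc⟩ := hn
    refine ⟨1, by norm_num, fun F => ?_⟩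
    rw [← sum_range_comp_affine (hper F) hcop c]
    refine Finset.sum_congr rfl fun i _ => ?_
    rw [one_mul]
    congr 2
    have hc' : (n : ℝ) = 2 * c + 1 := by exact_mod_cast hc
    push_cast
    field_simp
    linear_combination hc'

lemma exists_perm_cos (hd0 : 0 < d) (hM0 : 0 < M) (hM : 2 * N = d * M) (hcop : n.Coprime M) :
    ∃ ε : ℝ, ε * ε = 1 ∧ ∃ σ : Equiv.Perm (Fin N), ∀ l < N,
      ε * Real.cos ((2 * (permIndex σ l : ℝ) + 1) * (n * (Real.pi / M)))
        = Real.cos ((2 * ((l / d : ℕ) : ℝ) + 1) * (Real.pi / M)) := by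
  obtain ⟨ε, hε, hF⟩ := exists_sign_sum_comp_cos hM0 hcop
  refine ⟨ε, hε, ?_⟩
  obtain ⟨σ, hσ⟩ := exists_perm_comp_eq (N := N)
    (f := fun i => ε * Real.cos ((2 * ((i : ℕ) : ℝ) + 1) * (n * (Real.pi / M))))
    (g := fun l => Real.cos ((2 * (((l : ℕ) / d : ℕ) : ℝ) + 1) * (Real.pi / M))) (by
      intro F
      have h1 := sum_comp_cos_mul (n := n) hM0 hM fun x => F (ε * x)
      have h2 := sum_comp_cos_div hd0 hM0 hM F
      rw [hF F, ← h2, Finset.sum_range, Finset.sum_range] at h1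
      linarith)
  refine ⟨σ, fun l hl => ?_⟩
  rw [← hσ ⟨l, hl⟩, ← permIndex_fin]

/-- The extremal vector: blocks of length `d` are constant, and the remaining window sum of a
frequency-one cosine is a Dirichlet kernel, giving the singular value exactly. -/
lemma sum_cos_zigzagFold (hN0 : 0 < N) (hd0 : 0 < d) (hM2 : 2 ≤ M) (hn : m = d * n)
    (hM : 2 * N = d * M) (i : ℕ) :
    ∑ r ∈ Finset.range m,
        Real.cos ((2 * ((zigzagFold N (m * i + r) / d : ℕ) : ℝ) + 1) * (Real.pi / M))
      = d * (Real.sin (n * (Real.pi / M)) / Real.sin (Real.pi / M))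
        * Real.cos ((2 * (i : ℝ) + 1) * (n * (Real.pi / M))) := by
  have hpi := Real.pi_pos
  have hM0 : 0 < M := by omega
  have hM' : (2 : ℝ) ≤ M := by exact_mod_cast hM2
  have hs : 0 < Real.sin (Real.pi / M) := by
    refine Real.sin_pos_of_pos_of_lt_pi (by positivity) ?_
    rw [div_lt_iff₀ (by positivity)]
    nlinarith
  set G : ℕ → ℝ := fun l => Real.cos ((2 * ((l / d : ℕ) : ℝ) + 1) * (Real.pi / M)) with hG
  have hper : Function.Periodic G (2 * N) := by
    rw [hM]
    exact cos_div_periodic hd0 hM0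
  have hrefl : ∀ l < N, G (2 * N - 1 - l) = G l := by
    intro l hl
    simp only [hG]
    rw [hM]
    exact cos_div_reflect hd0 hM0 (by omega)
  have hfold : ∀ q, G (zigzagFold N q) = G q := comp_zigzagFold_of_symm hN0 hper hrefl
  change ∑ r ∈ Finset.range m, G (zigzagFold N (m * i + r)) = _
  simp only [hfold]
  have hblock : ∑ r ∈ Finset.range m, G (m * i + r)
      = d * ∑ p ∈ Finset.range n, Real.cos ((2 * ((n * i + p : ℕ) : ℝ) + 1) * (Real.pi / M)) := by
    rw [hn, mul_comm d n, sum_range_mul_eq (fun r => G (n * d * i + r)), Finset.mul_sum]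
    refine Finset.sum_congr rfl fun p _ => ?_
    have : ∀ t ∈ Finset.range d, G (n * d * i + (d * p + t))
        = Real.cos ((2 * ((n * i + p : ℕ) : ℝ) + 1) * (Real.pi / M)) := by
      intro t ht
      have e : n * d * i + (d * p + t) = d * (n * i + p) + t := by ring
      simp only [hG]
      rw [e, Nat.mul_add_div hd0, Nat.div_eq_of_lt (Finset.mem_range.1 ht), add_zero]
    rw [Finset.sum_congr rfl this]
    simp
  have hcos := sum_cos_mul_sin (Real.pi / M) (n * i) n
  have e : (2 * ((n * i : ℕ) : ℝ) + n) * (Real.pi / M) = (2 * (i : ℝ) + 1) * (n * (Real.pi / M)) := by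
    push_cast
    ring
  rw [e] at hcos
  rw [hblock, eq_div_of_mul_eq hs.ne' hcos]
  ring

lemma sum_cos_mul_eq_zero (hn0 : 0 < n) (hnM : 2 * n < M) (hM : 2 * N = d * M) :
    ∑ i ∈ Finset.range N, Real.cos ((2 * (i : ℝ) + 1) * (n * (Real.pi / M))) = 0 := by
  have hpi := Real.pi_pos
  have hM' : (0 : ℝ) < M := by exact_mod_cast (by omega : 0 < M)
  have hnM' : (2 : ℝ) * n ≤ M := by exact_mod_cast hnM.le
  have hn' : (0 : ℝ) < n := by positivity
  have hs : 0 < Real.sin (n * (Real.pi / M)) := by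
    refine Real.sin_pos_of_pos_of_lt_pi (by positivity) ?_
    rw [← mul_div_assoc, div_lt_iff₀ hM']
    nlinarith
  have h := sum_cos_mul_sin (n * (Real.pi / M)) 0 N
  have e2 : (2 : ℝ) * N = d * M := by exact_mod_cast hM
  have e3 : N * (n * (Real.pi / M)) = (n * d : ℕ) * Real.pi / 2 := by
    rw [show (N : ℝ) = d * M / 2 by linarith]
    push_cast
    field_simp
  have h0 : Real.cos (N * (n * (Real.pi / M))) * Real.sin (N * (n * (Real.pi / M))) = 0 := by
    have := Real.sin_two_mul (N * (n * (Real.pi / M)))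
    rw [e3, mul_div_cancel₀ _ two_ne_zero, Real.sin_nat_mul_pi] at this
    rw [e3]
    linarith
  simp only [Nat.cast_zero, mul_zero, zero_add] at h
  rw [h0] at h
  exact (mul_eq_zero.1 h).resolve_right hs.ne'

end Attained

lemma boundedVariationOn_cos_floor (N : ℕ) (ε a : ℝ) :
    BoundedVariationOn (fun x : ℝ => ε * Real.cos ((2 * (⌊(N : ℝ) * x⌋₊ : ℝ) + 1) * a))
      (Icc 0 1) := by
  have hmono : Monotone fun x : ℝ => (⌊(N : ℝ) * x⌋₊ : ℝ) := fun x y h =>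
    Nat.cast_le.2 (Nat.floor_le_floor (mul_le_mul_of_nonneg_left h (Nat.cast_nonneg N)))
  have hbv : BoundedVariationOn (fun x : ℝ => (⌊(N : ℝ) * x⌋₊ : ℝ)) (Icc 0 1) := by
    have := (hmono.monotoneOn (Icc (0 : ℝ) 1)).eVariationOn_eq
      (left_mem_Icc.2 zero_le_one) (right_mem_Icc.2 zero_le_one)
    rw [inter_self] at this
    exact (this.trans_lt ENNReal.ofReal_lt_top).ne
  have hlip : LipschitzWith (Real.toNNReal (|ε| * (2 * |a|)))
      fun y : ℝ => ε * Real.cos ((2 * y + 1) * a) := by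
    refine LipschitzWith.of_dist_le_mul fun x y => ?_
    rw [Real.coe_toNNReal _ (by positivity), Real.dist_eq, Real.dist_eq, ← mul_sub, abs_mul,
      mul_assoc]
    gcongr
    refine (Real.abs_cos_sub_cos_le _ _).trans_eq ?_
    rw [← sub_mul, add_sub_add_right_eq_sub, ← mul_sub, abs_mul, abs_mul, abs_two]
    ring
  exact hlip.comp_boundedVariationOn hbv

/-- The mesh function on `[0, 1]` with values `v i` on the cell of index `i`. -/
noncomputable def meshFunction (N : ℕ) (v : ℕ → ℝ) (x : ℝ) : ℝ :=
  v ⌊(N : ℝ) * x⌋₊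

lemma cellIntegral_mul_meshFunction {N : ℕ} (hN : 0 < N) (v : ℕ → ℝ) (Φ : ℝ → ℝ) (i : ℕ) :
    cellIntegral N i (fun x => Φ x * meshFunction N v x) = v i * cellIntegral N i Φ := by
  have hN' : (0 : ℝ) < N := by positivity
  rw [cellIntegral, cellIntegral, ← intervalIntegral.integral_const_mul]
  refine intervalIntegral.integral_congr_Ioo_of_le (by gcongr; linarith) ?_
  rintro x ⟨h1, h2⟩
  rw [div_lt_iff₀ hN'] at h1
  rw [lt_div_iff₀ hN'] at h2
  have hi : (0 : ℝ) ≤ i := by positivity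
  have hfl : ⌊(N : ℝ) * x⌋₊ = i := by
    rw [Nat.floor_eq_iff (by linarith)]
    constructor <;> linarith
  simp only [meshFunction, hfl]
  exact mul_comm _ _

lemma cellIntegral_meshFunction {N : ℕ} (hN : 0 < N) (v : ℕ → ℝ) (i : ℕ) :
    cellIntegral N i (meshFunction N v) = v i / N := by
  have h := cellIntegral_mul_meshFunction hN v (fun _ => 1) i
  simp only [one_mul] at h
  have h1 : cellIntegral N i (fun _ => 1) = 1 / N := by
    rw [cellIntegral, intervalIntegral.integral_const, smul_eq_mul, mul_one, ← sub_div,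
      add_sub_cancel_left]
  rw [h1, mul_one_div] at h
  exact h

lemma measurable_meshFunction (N : ℕ) (v : ℕ → ℝ) : Measurable (meshFunction N v) :=
  measurable_from_nat.comp (Nat.measurable_floor.comp (measurable_const_mul _))

/-- An eigenvector of the cell matrix yields cell integrals that evolve exactly geometrically. -/
lemma cellIntegral_iterate_meshFunction {m N : ℕ} (hm : 0 < m) (hN : 0 < N)
    {σ : Equiv.Perm (Fin N)} {v : ℕ → ℝ} {K s : ℝ} (hK : ∀ i, |v i| ≤ K)
    (hv : ∀ i < N, ∑ r ∈ Finset.range m, v (permIndex σ (zigzagFold N (m * i + r))) = m * s * v i)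
    (n : ℕ) {i : ℕ} (hi : i < N) :
    cellIntegral N i (meshFunction N v ∘ (permutedZigzag m σ)^[n]) = s ^ n * (v i / N) := by
  have hm' : (m : ℝ) ≠ 0 := by positivity
  induction n generalizing i with
  | zero => simpa using cellIntegral_meshFunction hN v i
  | succ n ih =>
    rw [cellIntegral_iterate_succ hm hN (measurable_meshFunction N v) (fun x => hK _)]
    have : ∀ r ∈ Finset.range m, cellIntegral N (permIndex σ (zigzagFold N (m * i + r)))
        (meshFunction N v ∘ (permutedZigzag m σ)^[n])
          = s ^ n / N * v (permIndex σ (zigzagFold N (m * i + r))) := by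
      intro r _
      rw [ih (permIndex_lt σ (zigzagFold_lt hN _))]
      ring
    rw [Finset.sum_congr rfl this, ← Finset.mul_sum, hv i hi, pow_succ]
    field_simp

lemma correlation_meshFunction {m N : ℕ} (hm : 0 < m) (hN : 0 < N)
    {σ : Equiv.Perm (Fin N)} {v : ℕ → ℝ} {K s : ℝ} (hK : ∀ i, |v i| ≤ K)
    (hv : ∀ i < N, ∑ r ∈ Finset.range m, v (permIndex σ (zigzagFold N (m * i + r))) = m * s * v i)
    (hv0 : ∑ i ∈ Finset.range N, v i = 0) (n : ℕ) :
    correlation (volume.restrict (Icc 0 1)) (permutedZigzag m σ) (meshFunction N v)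
      (meshFunction N v) n = s ^ n * ((∑ i ∈ Finset.range N, v i ^ 2) / N) := by
  have hmeas := measurable_meshFunction N v
  have hi0 := intervalIntegrable_of_measurable_of_bounded hmeas fun x => hK _
  have hi1 : ∀ a b, IntervalIntegrable (fun x => (meshFunction N v ∘ (permutedZigzag m σ)^[n]) x
      * meshFunction N v x) volume a b := by
    refine intervalIntegrable_of_measurable_of_bounded (K := K * K)
      ((hmeas.comp ((measurable_permutedZigzag m σ).iterate n)).mul hmeas) fun x => ?_
    rw [abs_mul]
    exact mul_le_mul (hK _) (hK _) (abs_nonneg _) ((abs_nonneg _).trans (hK 0))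
  have hz : ∫ x in (0 : ℝ)..1, meshFunction N v x = 0 := by
    rw [← sum_cellIntegral hi0 hN]
    simp only [cellIntegral_meshFunction hN]
    rw [← Finset.sum_div, hv0, zero_div]
  rw [correlation, integral_restrict_Icc_zero_one (f := meshFunction N v) fun x _ => rfl, hz,
    mul_zero, sub_zero, integral_restrict_Icc_zero_one (f := fun x =>
      meshFunction N v ((permutedZigzag m σ)^[n] x) * meshFunction N v x) (h := fun x =>
      (meshFunction N v ∘ (permutedZigzag m σ)^[n]) x * meshFunction N v x) (fun x _ => rfl),
    ← sum_cellIntegral hi1 hN, Finset.sum_div, Finset.mul_sum]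
  refine Finset.sum_congr rfl fun i hi => ?_
  rw [cellIntegral_mul_meshFunction hN,
    cellIntegral_iterate_meshFunction hm hN hK hv n (Finset.mem_range.1 hi)]
  ring

lemma exists_perm_zigzagRate_le_mixingRate {m N : ℕ} (hm : 2 ≤ m) (hN : m < N) :
    ∃ σ : Equiv.Perm (Fin N),
      zigzagRate m N ≤ mixingRate (volume.restrict (Icc 0 1)) (permutedZigzag m σ) := by
  have hpi := Real.pi_pos
  set d := Nat.gcd m (2 * N) with hd
  have hd0 : 0 < d := Nat.gcd_pos_of_pos_left _ (by omega)
  obtain ⟨n, hn⟩ : d ∣ m := Nat.gcd_dvd_left _ _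
  obtain ⟨M, hM⟩ : d ∣ 2 * N := Nat.gcd_dvd_right _ _
  have hcop : n.Coprime M := by
    refine Nat.eq_of_mul_eq_mul_left hd0 ?_
    rw [← Nat.gcd_mul_left, ← hn, ← hM, mul_one]
  have hM0 : 0 < M := Nat.pos_of_ne_zero (by rintro rfl; omega)
  have hn0 : 0 < n := Nat.pos_of_ne_zero (by rintro rfl; omega)
  -- Strictness makes `cos(nπ/M)` positive, so that the eigenvector is nonzero.
  have hnM : 2 * n < M := by
    refine Nat.lt_of_mul_lt_mul_left (a := d) ?_
    calc d * (2 * n) = 2 * m := by rw [hn]; ring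
      _ < d * M := by omega
  have hN0 : 0 < N := by omega
  have hN' : (0 : ℝ) < N := by positivity
  have hs := zigzagRate_pos hm hN
  obtain ⟨ε, hε, σ, hσ⟩ := exists_perm_cos hd0 hM0 hM hcop
  refine ⟨σ, ?_⟩
  set w : ℕ → ℝ := fun i => Real.cos ((2 * (i : ℝ) + 1) * (n * (Real.pi / M))) with hw
  set v : ℕ → ℝ := fun i => ε * w i with hvdef
  have hK : ∀ i, |v i| ≤ |ε| := by
    intro i
    simp only [hvdef, abs_mul]
    exact mul_le_of_le_one_right (abs_nonneg _) (Real.abs_cos_le_one _)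
  have hv : ∀ i < N, ∑ r ∈ Finset.range m, v (permIndex σ (zigzagFold N (m * i + r)))
      = m * (ε * zigzagRate m N) * v i := by
    intro i _
    have h1 := sum_cos_zigzagFold hN0 hd0 (by omega) hn hM i
    rw [← mul_zigzagRate hd hd0 hn0 hM0 hn hM] at h1
    calc _ = m * zigzagRate m N * w i := by
          rw [← h1]
          exact Finset.sum_congr rfl fun r _ => hσ _ (zigzagFold_lt hN0 _)
      _ = _ := by
          simp only [hvdef]
          linear_combination (-(m * zigzagRate m N * w i)) * hε
  have hv0 : ∑ i ∈ Finset.range N, v i = 0 := by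
    simp only [hvdef]
    rw [← Finset.mul_sum, sum_cos_mul_eq_zero hn0 hnM hM, mul_zero]
  have hw0 : 0 < w 0 := by
    have hnM' : (2 : ℝ) * n < M := by exact_mod_cast hnM
    have hM' : (0 : ℝ) < M := by positivity
    have hlt : n * (Real.pi / M) < Real.pi / 2 := by
      rw [← mul_div_assoc, div_lt_div_iff₀ hM' two_pos]
      nlinarith
    have hpos : 0 ≤ n * (Real.pi / M) := by positivity
    simp only [hw, Nat.cast_zero, mul_zero, zero_add, one_mul]
    exact Real.cos_pos_of_mem_Ioo ⟨by linarith, hlt⟩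
  have hc : 0 < (∑ i ∈ Finset.range N, v i ^ 2) / N := by
    refine div_pos ?_ hN'
    refine Finset.sum_pos' (fun i _ => sq_nonneg _) ⟨0, Finset.mem_range.2 hN0, ?_⟩
    simp only [hvdef]
    rw [mul_pow, sq ε, hε, one_mul]
    positivity
  set c := (∑ i ∈ Finset.range N, v i ^ 2) / N with hcdef
  -- The set of admissible `τ` must be nonempty for its real infimum to be bounded below this way;
  -- any number above the rate belongs to it.
  refine le_csInf ⟨zigzagRate m N + 1, by linarith, fun φ ψ hφ hψ =>
    correlation_isBigO hm hN (lt_add_one _) hφ hψ⟩ ?_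
  rintro τ ⟨hτ, hO⟩
  by_contra! hlt
  have hbv : BoundedVariationOn (meshFunction N v) (Icc 0 1) :=
    boundedVariationOn_cos_floor N ε (n * (Real.pi / M))
  have h1 := hO _ _ hbv hbv
  simp only [correlation_meshFunction (by omega) hN0 hK hv hv0] at h1
  -- An admissible `τ` below the rate would make `s^n` negligible against itself.
  have h2 := h1.trans_isLittleO (isLittleO_pow_pow_of_lt_left hτ hlt)
  have hεabs : |ε| = 1 := by
    have := abs_mul_abs_self ε
    rw [hε] at this
    nlinarith [abs_nonneg ε]
  have h3 : (fun n : ℕ => zigzagRate m N ^ n)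
      =O[atTop] fun n : ℕ => (ε * zigzagRate m N) ^ n * c := by
    refine IsBigO.of_bound (1 / c) (Eventually.of_forall fun n => ?_)
    simp only [norm_mul, norm_pow, Real.norm_eq_abs, hεabs, abs_of_pos hs, abs_of_pos hc, one_mul]
    rw [mul_comm, mul_assoc, mul_one_div_cancel hc.ne', mul_one]
  exact isLittleO_irrefl (Frequently.of_forall fun n => (pow_pos hs n).ne') (h3.trans_isLittleO h2)

lemma worstMixingRate_zigzag {m N : ℕ} (hm : 2 ≤ m) (hN : m < N) :
    worstMixingRate N (zigzag m) = zigzagRate m N := by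
  apply le_antisymm
  · exact Finset.sup'_le _ _ fun σ _ => mixingRate_permutedZigzag_le hm hN σ
  · obtain ⟨σ, hσ⟩ := exists_perm_zigzagRate_le_mixingRate hm hN
    exact hσ.trans (Finset.le_sup' (fun σ => mixingRate (volume.restrict (Icc 0 1))
      (intervalExchange N σ ∘ zigzag m)) (Finset.mem_univ σ))

theorem theorem1p3 (m N : ℕ) (hm : 2 ≤ m) (hN : m < N) :
    worstMixingRate N (zigzag m) =
        (Nat.gcd m (2 * N) : ℝ) * Real.sin (m * Real.pi / (2 * N)) /
          (m * Real.sin ((Nat.gcd m (2 * N) : ℝ) * Real.pi / (2 * N))) ∧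
      (Nat.gcd m (2 * N) = 1 →
        worstMixingRate N (zigzag m) =
          Real.sin (m * Real.pi / (2 * N)) / (m * Real.sin (Real.pi / (2 * N)))) := by
  have h := worstMixingRate_zigzag hm hN
  refine ⟨h, fun hd => ?_⟩
  rw [h, zigzagRate, hd, Nat.cast_one, one_mul, one_mul]
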